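/- Let $0<L_1\le L_2$, $L=L_1+L_2$, and suppose that $L_1/L$ is irrational. Consider the boundary value problems $$(P_\pm)\qquad -u''-u^3=\omega u \text{ on } [0,L],\quad \omega<0,\quad u\in H^2([0,L]),\ u(0)=u(L),\ u'(0)=u'(L),\quad u(0)=\pm u(L_1)=\sqrt{2|\omega|}.$$ Let $K(k)=\int_0^1\frac{dt}{\sqrt{(1-t^2)(1-k^2t^2)}}$ be the complete elliptic integral of the first kind, $\mathrm{cn}(\cdot\,;k)$ the Jacobi elliptic cosine of modulus $k$, and $S(k)=4\sqrt{2k^2-1}\,K(k)$ for $k\in(1/\sqrt2,1)$, an increasing bijection onto $(0,\infty)$. For integers $n\ge1$ put $r_n=\frac{L_1}{L}n-\left\lfloor\frac{L_1}{L}n+\frac12\right\rfloor$, $s_n^+=\frac{L}{2n}r_n$, $s_n^-=\frac{L}{2n}\left(|r_n|-\frac12\right)\mathrm{sgn}(r_n)$. For every $n\ge 1$ and each choice of the sign there is exactly one $\omega=\omega_n^\pm<0$ such that $\omega$ together with the function $$u_n^\pm(x)=\sqrt{\frac{2|\omega|k^2}{2k^2-1}}\ \mathrm{cn}\left(\sqrt{\frac{|\omega|}{2k^2-1}}\,(x-s_n^\pm);k\right),\qquad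 k=S^{-1}\left(\frac{L\sqrt{|\omega|}}{n}\right),$$ solves $(P_\pm)$. Both frequency sequences $\{\omega_n^+\}_{n\ge1}$ and $\{\omega_n^-\}_{n\ge1}$ are unbounded below, and each of them has at least one finite cluster point (limit of a subsequence) lying, respectively, in $$I^+=\left[-\frac{1}{L^2}K\left(\tfrac1{\sqrt2}\right)^4,\,0\right]\qquad\text{and}\qquad I^-=\left[-\frac{16}{5L^2}K\left(\tfrac1{\sqrt2}\right)^4,\,0\right].$$ -/

import Mathlib

open Set Filter Topology MeasureTheory

noncomputable section

/-- Legendre's incomplete elliptic integral of the first kind,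
`F(θ; k) = ∫₀^θ ds / √(1 - k² sin² s)`. -/
def ellipticF (k θ : ℝ) : ℝ :=
  ∫ s in (0 : ℝ)..θ, 1 / √(1 - k ^ 2 * Real.sin s ^ 2)

/-- The complete elliptic integral of the first kind, `K(k) = F(π/2; k)`.  The substitution
`t = sin s` turns it into `∫₀¹ dt / √((1 - t²)(1 - k² t²))`. -/
def ellipticK (k : ℝ) : ℝ := ellipticF k (Real.pi / 2)

/-- The Jacobi amplitude `am(·; k)`: the inverse of the increasing bijection
`F(·; k) : ℝ → ℝ`, for `0 ≤ k < 1`. -/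
def jacobiAm (k y : ℝ) : ℝ := Function.invFun (ellipticF k) y

/-- The Jacobi elliptic cosine `cn(y; k) = cos (am(y; k))`. -/
def jacobiCn (k y : ℝ) : ℝ := Real.cos (jacobiAm k y)

/-- The function `S(k) = 4 √(2k² - 1) K(k)`, considered on `(1/√2, 1)`. -/
def periodS (k : ℝ) : ℝ := 4 * √(2 * k ^ 2 - 1) * ellipticK k

/-- `u` belongs to `H²([0, L])` (continuous representative), with first derivative `v` and second
weak derivative `w ∈ L²`: both `u` and `v` are absolutely continuous on `[0, L]`, being
primitives of `v` and of `w`. -/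
structure IsH2 (L : ℝ) (u v w : ℝ → ℝ) : Prop where
  memLp : MemLp w 2 (volume.restrict (Icc 0 L))
  deriv_eq : ∀ x ∈ Icc 0 L, v x = v 0 + ∫ t in (0 : ℝ)..x, w t
  eq : ∀ x ∈ Icc 0 L, u x = u 0 + ∫ t in (0 : ℝ)..x, v t

/-- `(ω, u)` solves the boundary value problem `(P_σ)`, where `σ = 1` or `σ = -1`:
`-u'' - u³ = ω u` on `[0, L]`, `u ∈ H²_per([0, L])`, `ω < 0`, and
`u(0) = σ u(L₁) = √(2|ω|)`. -/
def SolvesP (σ L L₁ ω : ℝ) (u : ℝ → ℝ) : Prop :=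
  ω < 0 ∧
  (∃ v w : ℝ → ℝ, IsH2 L u v w ∧ u 0 = u L ∧ v 0 = v L ∧
    ∀ᵐ x ∂(volume.restrict (Icc 0 L)), -w x - u x ^ 3 = ω * u x) ∧
  u 0 = σ * u L₁ ∧ σ * u L₁ = √(2 * |ω|)

/-- The modulus `k = S⁻¹(L √|ω| / n) ∈ (1/√2, 1)`. -/
def modulus (L : ℝ) (n : ℕ+) (ω : ℝ) : ℝ :=
  Function.invFunOn periodS (Ioo (1 / √2) 1) (L * √|ω| / (n : ℝ))

/-- The cnoidal wave of frequency `ω` and period `L / n` with a maximum point at `s`: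
`x ↦ √(2|ω|k² / (2k² - 1)) cn(√(|ω| / (2k² - 1)) (x - s); k)` with `k = S⁻¹(L √|ω| / n)`. -/
def cnoidal (L : ℝ) (n : ℕ+) (ω s x : ℝ) : ℝ :=
  √(2 * |ω| * modulus L n ω ^ 2 / (2 * modulus L n ω ^ 2 - 1)) *
    jacobiCn (modulus L n ω) (√(|ω| / (2 * modulus L n ω ^ 2 - 1)) * (x - s))

/-- `r_n = (L₁/L) n - [(L₁/L) n + 1/2]`, with `[·]` the integer part. -/
def rSeq (L L₁ : ℝ) (n : ℕ+) : ℝ :=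
  L₁ / L * (n : ℝ) - (⌊L₁ / L * (n : ℝ) + 1 / 2⌋ : ℝ)

/-- The translation `s_n⁺ = (L / 2n) r_n`. -/
def shiftPlus (L L₁ : ℝ) (n : ℕ+) : ℝ := L / (2 * (n : ℝ)) * rSeq L L₁ n

/-- The translation `s_n⁻ = (L / 2n) (|r_n| - 1/2) sgn(r_n)`. -/
def shiftMinus (L L₁ : ℝ) (n : ℕ+) : ℝ :=
  L / (2 * (n : ℝ)) * (|rSeq L L₁ n| - 1 / 2) * Real.sign (rSeq L L₁ n)

/-- `ω` is an `n`-th frequency of `(P₊)`: together with the cnoidal wave of period `L / n`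
translated by `s_n⁺`, it solves `(P₊)`. -/
def IsFrequencyPlus (L L₁ : ℝ) (n : ℕ+) (ω : ℝ) : Prop :=
  SolvesP 1 L L₁ ω (cnoidal L n ω (shiftPlus L L₁ n))

/-- `ω` is an `n`-th frequency of `(P₋)`: together with the cnoidal wave of period `L / n`
translated by `s_n⁻`, it solves `(P₋)`. -/
def IsFrequencyMinus (L L₁ : ℝ) (n : ℕ+) (ω : ℝ) : Prop :=
  SolvesP (-1) L L₁ ω (cnoidal L n ω (shiftMinus L L₁ n))

end

/-! For every `ω < 0` and every shift the cnoidal wave is an `L`-periodic solution of the equation.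
The shifts `s_n^±` are chosen so that evenness and (anti)periodicity of `cn` give `u(0) = ± u(L₁)`.
What remains is `u(0) = √(2|ω|)`, that is, `cn(θ K(k); k) = √(2k² - 1)/k` with `θ = 2|r_n|` for `+`
and `θ = 1 - 2|r_n|` for `-`. With `φ` the angle of cosine `√(2k² - 1)/k`, this reads `F(φ; k)/K(k)
= θ`. The left side (`matchRatio`) decreases strictly from 1 to 0 on `(1/√2, 1)`, so `k` is
determined by `θ`, and then `ω = -(n S(k)/L)²` (`isFrequencyPlus_iff`, `isFrequencyMinus_iff`).

Along `n → ∞` with `θ_n < 1/2`, `S(k)` stays away from 0 and `ω_n → -∞`. Along `n → ∞` with `θ_n →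
1` the modulus tends to `1/√2`, and `periodS_le` gives `S(k) ≤ 4k²K(k)²(1 - θ)`. If moreover `n(1 -
θ_n) ≤ C`, then `ω_n` has a cluster point in `[-(2C K(1/√2)²/L)², 0]`
(`exists_mapClusterPt_frequency`).

The constants come from Diophantine approximation of `ξ = L₁/L`. For `-`, `1 - θ = 2|r_n|`, and
Hurwitz's theorem gives `C = 2/√5`. For `+`, `1 - θ = 1 - 2|r_n|` is small when `ξ` is close to a
fraction with odd numerator and denominator `2n`; such fractions achieve `q|qξ - p| ≤ 1`, whence `C
= 1/2`. -/

/-! ### The elliptic integral `F`, the amplitude and `cn` -/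

lemma one_sub_sq_mul_sin_sq_pos {k : ℝ} (hk : k ^ 2 < 1) (s : ℝ) :
    0 < 1 - k ^ 2 * Real.sin s ^ 2 := by
  have := mul_le_of_le_one_right (sq_nonneg k) (Real.sin_sq_le_one s)
  linarith

lemma continuous_ellipticF_integrand {k : ℝ} (hk : k ^ 2 < 1) :
    Continuous fun s => 1 / √(1 - k ^ 2 * Real.sin s ^ 2) :=
  Continuous.div (by fun_prop) (by fun_prop)
    fun s => (Real.sqrt_pos.2 (one_sub_sq_mul_sin_sq_pos hk s)).ne'

lemma hasDerivAt_ellipticF {k : ℝ} (hk : k ^ 2 < 1) (θ : ℝ) :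
    HasDerivAt (ellipticF k) (1 / √(1 - k ^ 2 * Real.sin θ ^ 2)) θ :=
  ((continuous_ellipticF_integrand hk).integral_hasStrictDerivAt 0 θ).hasDerivAt

lemma continuous_ellipticF {k : ℝ} (hk : k ^ 2 < 1) : Continuous (ellipticF k) :=
  continuous_iff_continuousAt.2 fun θ => (hasDerivAt_ellipticF hk θ).continuousAt

lemma strictMono_ellipticF {k : ℝ} (hk : k ^ 2 < 1) : StrictMono (ellipticF k) := by
  refine strictMono_of_deriv_pos fun θ => ?_
  rw [(hasDerivAt_ellipticF hk θ).deriv]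
  exact one_div_pos.2 (Real.sqrt_pos.2 (one_sub_sq_mul_sin_sq_pos hk θ))

@[simp] lemma ellipticF_zero (k : ℝ) : ellipticF k 0 = 0 := by simp [ellipticF]

lemma ellipticF_neg (k θ : ℝ) : ellipticF k (-θ) = -ellipticF k θ := by
  have := intervalIntegral.integral_comp_neg (a := 0) (b := θ)
    (fun s => 1 / √(1 - k ^ 2 * Real.sin s ^ 2))
  simp only [Real.sin_neg, neg_sq, neg_zero] at this
  rw [ellipticF, ellipticF, intervalIntegral.integral_symm, this]

lemma ellipticF_sub_eq {k : ℝ} (hk : k ^ 2 < 1) (a b : ℝ) :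
    ellipticF k b - ellipticF k a = ∫ s in a..b, 1 / √(1 - k ^ 2 * Real.sin s ^ 2) := by
  have h := fun a b => (continuous_ellipticF_integrand hk).intervalIntegrable (μ := volume) a b
  exact intervalIntegral.integral_interval_sub_left (h 0 b) (h 0 a)

/-- The integrand has period `π`, so the increment can be computed on `[-π/2, π/2]`, where oddness
of `F` yields `2K`. -/
lemma ellipticF_add_pi {k : ℝ} (hk : k ^ 2 < 1) (θ : ℝ) :
    ellipticF k (θ + Real.pi) = ellipticF k θ + 2 * ellipticK k := by
  have hper : Function.Periodic (fun s => 1 / √(1 - k ^ 2 * Real.sin s ^ 2)) Real.pi := by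
    intro s
    simp [Real.sin_add_pi]
  have h1 := ellipticF_sub_eq hk θ (θ + Real.pi)
  rw [hper.intervalIntegral_add_eq θ (-(Real.pi / 2)), ← ellipticF_sub_eq hk,
    show -(Real.pi / 2) + Real.pi = Real.pi / 2 by ring, ellipticF_neg] at h1
  rw [ellipticK]
  linarith

lemma le_ellipticF {k θ : ℝ} (hk : k ^ 2 < 1) (hθ : 0 ≤ θ) : θ ≤ ellipticF k θ := by
  have : ∫ _ in (0 : ℝ)..θ, (1 : ℝ) ≤ ellipticF k θ := by
    refine intervalIntegral.integral_mono_on hθ (by simp)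
      ((continuous_ellipticF_integrand hk).intervalIntegrable _ _) fun s _ => ?_
    rw [le_div_iff₀ (Real.sqrt_pos.2 (one_sub_sq_mul_sin_sq_pos hk s)), one_mul,
      Real.sqrt_le_one]
    nlinarith [mul_nonneg (sq_nonneg k) (sq_nonneg (Real.sin s))]
  simpa using this

lemma surjective_ellipticF {k : ℝ} (hk : k ^ 2 < 1) : Function.Surjective (ellipticF k) := by
  have htop : Tendsto (ellipticF k) atTop atTop :=
    tendsto_atTop_mono' _ ((eventually_ge_atTop 0).mono fun θ h => le_ellipticF hk h) tendsto_id
  refine (continuous_ellipticF hk).surjective htop ?_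
  have : ellipticF k = fun θ => -ellipticF k (-θ) := by
    funext θ
    rw [ellipticF_neg, neg_neg]
  rw [this]
  exact tendsto_neg_atTop_atBot.comp (htop.comp tendsto_neg_atBot_atTop)

lemma ellipticF_jacobiAm {k : ℝ} (hk : k ^ 2 < 1) (y : ℝ) : ellipticF k (jacobiAm k y) = y :=
  Function.invFun_eq (surjective_ellipticF hk y)

lemma jacobiAm_ellipticF {k : ℝ} (hk : k ^ 2 < 1) (θ : ℝ) : jacobiAm k (ellipticF k θ) = θ :=
  Function.leftInverse_invFun (strictMono_ellipticF hk).injective θ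

lemma strictMono_jacobiAm {k : ℝ} (hk : k ^ 2 < 1) : StrictMono (jacobiAm k) := fun x y h => by
  rwa [← (strictMono_ellipticF hk).lt_iff_lt, ellipticF_jacobiAm hk, ellipticF_jacobiAm hk]

lemma continuous_jacobiAm {k : ℝ} (hk : k ^ 2 < 1) : Continuous (jacobiAm k) :=
  (strictMono_jacobiAm hk).monotone.continuous_of_surjective
    fun θ => ⟨_, jacobiAm_ellipticF hk θ⟩

lemma hasDerivAt_jacobiAm {k : ℝ} (hk : k ^ 2 < 1) (y : ℝ) :
    HasDerivAt (jacobiAm k) (√(1 - k ^ 2 * Real.sin (jacobiAm k y) ^ 2)) y := by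
  have hpos := Real.sqrt_pos.2 (one_sub_sq_mul_sin_sq_pos hk (jacobiAm k y))
  have := HasDerivAt.of_local_left_inverse (continuous_jacobiAm hk).continuousAt
    (hasDerivAt_ellipticF hk (jacobiAm k y)) (by positivity)
    (Eventually.of_forall fun z => ellipticF_jacobiAm hk z)
  simpa using this

lemma jacobiAm_neg {k : ℝ} (hk : k ^ 2 < 1) (y : ℝ) : jacobiAm k (-y) = -jacobiAm k y := by
  apply (strictMono_ellipticF hk).injective
  rw [ellipticF_neg, ellipticF_jacobiAm hk, ellipticF_jacobiAm hk]

lemma jacobiAm_add {k : ℝ} (hk : k ^ 2 < 1) (y : ℝ) :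
    jacobiAm k (y + 2 * ellipticK k) = jacobiAm k y + Real.pi := by
  apply (strictMono_ellipticF hk).injective
  rw [ellipticF_add_pi hk, ellipticF_jacobiAm hk, ellipticF_jacobiAm hk]

lemma jacobiCn_neg {k : ℝ} (hk : k ^ 2 < 1) (y : ℝ) : jacobiCn k (-y) = jacobiCn k y := by
  rw [jacobiCn, jacobiAm_neg hk, Real.cos_neg, jacobiCn]

lemma jacobiAm_add_int {k : ℝ} (hk : k ^ 2 < 1) (y : ℝ) (m : ℤ) :
    jacobiAm k (y + m * (4 * ellipticK k)) = jacobiAm k y + m * (2 * Real.pi) := by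
  have h4 : ∀ y, jacobiAm k (y + 4 * ellipticK k) = jacobiAm k y + 2 * Real.pi := fun y => by
    rw [show y + 4 * ellipticK k = y + 2 * ellipticK k + 2 * ellipticK k by ring,
      jacobiAm_add hk, jacobiAm_add hk]
    ring
  induction m with
  | zero => simp
  | succ i ih =>
    push_cast at ih ⊢
    rw [show y + ((i : ℝ) + 1) * (4 * ellipticK k)
      = y + i * (4 * ellipticK k) + 4 * ellipticK k by ring, h4, ih]
    ring
  | pred i ih =>
    push_cast at ih ⊢
    have := h4 (y + (-(i : ℝ) - 1) * (4 * ellipticK k))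
    rw [show y + (-(i : ℝ) - 1) * (4 * ellipticK k) + 4 * ellipticK k
      = y + -i * (4 * ellipticK k) by ring, ih] at this
    linarith

lemma jacobiCn_add_int {k : ℝ} (hk : k ^ 2 < 1) (y : ℝ) (m : ℤ) :
    jacobiCn k (y + m * (4 * ellipticK k)) = jacobiCn k y := by
  rw [jacobiCn, jacobiAm_add_int hk, Real.cos_add_int_mul_two_pi, jacobiCn]

lemma jacobiCn_add_half {k : ℝ} (hk : k ^ 2 < 1) (y : ℝ) :
    jacobiCn k (y + 2 * ellipticK k) = -jacobiCn k y := by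
  rw [jacobiCn, jacobiAm_add hk, Real.cos_add_pi, jacobiCn]

/-- The derivative `-sn dn` of `cn`. -/
noncomputable def jacobiCnDeriv (k y : ℝ) : ℝ :=
  -(Real.sin (jacobiAm k y) * √(1 - k ^ 2 * Real.sin (jacobiAm k y) ^ 2))

lemma hasDerivAt_jacobiCn {k : ℝ} (hk : k ^ 2 < 1) (y : ℝ) :
    HasDerivAt (jacobiCn k) (jacobiCnDeriv k y) y := by
  have := (hasDerivAt_jacobiAm hk y).cos
  rw [jacobiCnDeriv, ← neg_mul]
  exact this

/-- The second-order equation of `cn`; rescaling it gives the cubic equation of the boundary value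
problem. -/
lemma hasDerivAt_jacobiCnDeriv {k : ℝ} (hk : k ^ 2 < 1) (y : ℝ) :
    HasDerivAt (jacobiCnDeriv k)
      ((2 * k ^ 2 - 1) * jacobiCn k y - 2 * k ^ 2 * jacobiCn k y ^ 3) y := by
  have hpos := one_sub_sq_mul_sin_sq_pos hk (jacobiAm k y)
  have hs := (hasDerivAt_jacobiAm hk y).sin
  have hd : HasDerivAt (fun z => √(1 - k ^ 2 * Real.sin (jacobiAm k z) ^ 2)) _ y :=
    (((hs.pow 2).const_mul (k ^ 2)).const_sub 1).sqrt hpos.ne'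
  have h : HasDerivAt (jacobiCnDeriv k) _ y := (hs.mul hd).neg
  refine h.congr_deriv ?_
  have hsq := Real.sq_sqrt hpos.le
  have hne := (Real.sqrt_pos.2 hpos).ne'
  have hsc := Real.sin_sq_add_cos_sq (jacobiAm k y)
  simp only [jacobiCn, Pi.pow_apply]
  set c := Real.cos (jacobiAm k y)
  set s := Real.sin (jacobiAm k y)
  set d := √(1 - k ^ 2 * s ^ 2)
  have hs2 : s ^ 2 = 1 - c ^ 2 := by linarith
  field_simp
  simp only [Nat.reduceSub, pow_one, Nat.cast_ofNat]
  rw [hsq, hs2]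
  linear_combination 2 * c * k ^ 2 * hs2

lemma jacobiCnDeriv_add_int {k : ℝ} (hk : k ^ 2 < 1) (y : ℝ) (m : ℤ) :
    jacobiCnDeriv k (y + m * (4 * ellipticK k)) = jacobiCnDeriv k y := by
  rw [jacobiCnDeriv, jacobiAm_add_int hk, Real.sin_add_int_mul_two_pi, jacobiCnDeriv]

/-! ### Diophantine approximation -/

/-- Two vectors of a basis of `ℤ²` on which the linear form `q ξ - p` is small and takes values
of opposite signs, the first of them being a Dirichlet approximation. -/
lemma exists_unimodular_pair {ξ : ℝ} (hξ : Irrational ξ) {ε : ℝ} (hε : 0 < ε) :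
    ∃ (e a b c d : ℤ) (x y : ℝ), (e = 1 ∨ e = -1) ∧ 0 < b ∧ 0 < d ∧ b * c - a * d = e ∧
      b * ξ - a = e * x ∧ d * ξ - c = -(e * y) ∧ 0 < y ∧ y < x ∧ x < ε ∧ b * x < 1 ∧
      d * x + b * y = 1 := by
  obtain ⟨n, hn⟩ := exists_nat_gt (1 / ε)
  have hn0 : 0 < (n : ℝ) := (one_div_pos.2 hε).trans hn
  have hn1 : 0 < n := by exact_mod_cast hn0
  obtain ⟨q, hq, hqn⟩ := ξ.exists_rat_abs_sub_le_and_den_le hn1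
  obtain ⟨u, v, huv⟩ : ∃ u v : ℤ, (q.den : ℤ) * u + q.num * v = 1 := by
    have hcop : IsCoprime q.num (q.den : ℤ) := Int.isCoprime_iff_gcd_eq_one.2 q.reduced
    obtain ⟨v, u, h⟩ := hcop
    exact ⟨u, v, by linarith⟩
  have hb : 0 < (q.den : ℤ) := by exact_mod_cast q.pos
  have hbn : ((q.den : ℤ) : ℝ) ≤ n := by exact_mod_cast hqn
  have hbR : 0 < ((q.den : ℤ) : ℝ) := by exact_mod_cast hb
  have habs : |((q.den : ℤ) : ℝ) * ξ - q.num| ≤ 1 / (n + 1) := by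
    have hqd : (q : ℝ) = q.num / ((q.den : ℤ) : ℝ) := by
      conv_lhs => rw [← Rat.num_div_den q]
      push_cast
      rfl
    have : ((q.den : ℤ) : ℝ) * ξ - q.num = (q.den : ℤ) * (ξ - q) := by
      rw [hqd]
      field_simp
    rw [this, abs_mul, abs_of_pos hbR]
    refine (mul_le_mul_of_nonneg_left hq hbR.le).trans_eq ?_
    rw [Int.cast_natCast] at hbR ⊢
    field_simp
  have hne : ((q.den : ℤ) : ℝ) * ξ - q.num ≠ 0 := ((hξ.intCast_mul hb.ne').sub_intCast _).ne_zero
  generalize (q.den : ℤ) = b at *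
  generalize q.num = a at *
  obtain ⟨e, he, hex⟩ : ∃ e : ℤ, (e = 1 ∨ e = -1) ∧
      (b : ℝ) * ξ - a = e * |(b : ℝ) * ξ - a| := by
    rcases abs_choice ((b : ℝ) * ξ - a) with h | h
    · exact ⟨1, Or.inl rfl, by rw [h]; simp⟩
    · exact ⟨-1, Or.inr rfl, by rw [h]; simp⟩
  have hx0 : 0 < |(b : ℝ) * ξ - a| := abs_pos.2 hne
  set x := |(b : ℝ) * ξ - a|
  have hee : e * e = 1 := by rcases he with rfl | rfl <;> rfl
  have heeR : (e : ℝ) * e = 1 := by exact_mod_cast hee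
  -- The Bézout vector completes `(a, b)` to a basis. Adding `t` copies of `(a, b)`, with `t = ⌊y₀ /
  -- x⌋`, keeps the determinant and brings the second value into `[0, x)`.
  set y₀ : ℝ := e * (e * u - (-(e * v)) * ξ) with hy₀
  set t : ℤ := ⌊y₀ / x⌋
  have ht0 : 0 ≤ y₀ - t * x := by
    have := Int.floor_le (y₀ / x)
    rw [le_div_iff₀ hx0] at this
    linarith
  have ht1 : y₀ - t * x < x := by
    have := Int.lt_floor_add_one (y₀ / x)
    rw [div_lt_iff₀ hx0] at this
    linarith
  have hdet : b * (e * u + t * a) - a * (-(e * v) + t * b) = e := by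
    linear_combination e * huv
  have huvR : (b : ℝ) * u + a * v = 1 := by exact_mod_cast huv
  have hy : ((-(e * v) + t * b : ℤ) : ℝ) * ξ - ((e * u + t * a : ℤ) : ℝ) =
      -(e * (y₀ - t * x)) := by
    push_cast
    rw [hy₀]
    linear_combination (e * u + e * v * ξ) * heeR + t * hex
  have hxa : (e : ℝ) * (b * ξ - a) = x := by linear_combination e * hex + x * heeR
  have hone : ((-(e * v) + t * b : ℤ) : ℝ) * x + b * (y₀ - t * x) = 1 := by
    push_cast
    rw [← hxa, hy₀]
    linear_combination ((b : ℝ) * u + a * v) * heeR + huvR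
  have hbx : b * x < 1 := by
    calc (b : ℝ) * x ≤ n * (1 / (n + 1)) := by gcongr
      _ < 1 := by rw [mul_one_div, div_lt_one (by positivity)]; linarith
  have hxε : x < ε := by
    refine habs.trans_lt ?_
    rw [div_lt_iff₀ hε] at hn
    rw [div_lt_iff₀ (by positivity)]
    linarith
  have hdpos : 0 < ((-(e * v) + t * b : ℤ) : ℝ) := by
    have : (b : ℝ) * (y₀ - t * x) < 1 :=
      (mul_lt_mul_of_pos_left ht1 hbR).trans hbx
    by_contra! hcon
    have := mul_nonpos_of_nonpos_of_nonneg hcon hx0.le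
    linarith
  have hd : 0 < -(e * v) + t * b := by exact_mod_cast hdpos
  refine ⟨e, a, b, e * u + t * a, -(e * v) + t * b, x, y₀ - t * x, he, hb, hd, hdet, hex, hy,
    ht0.lt_of_ne fun h0 => ?_, ht1, hxε, hbx, hone⟩
  rw [← h0, mul_zero, neg_zero] at hy
  exact ((hξ.intCast_mul hd.ne').sub_intCast _).ne_zero hy

/-- The inequality behind Hurwitz's theorem, for two Farey neighbours and their mediant. -/
lemma farey_triple_le {b d x y : ℝ} (hb : 0 < b) (hd : 0 < d) (hx : 0 < x) (hy : 0 < y)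
    (h : d * x + b * y = 1) :
    b * x ≤ 1 / √5 ∨ d * y ≤ 1 / √5 ∨ (b + d) * (x - y) ≤ 1 / √5 := by
  by_contra! hcon
  obtain ⟨h1, h2, h3⟩ := hcon
  have h5 : √5 ^ 2 = 5 := Real.sq_sqrt (by norm_num)
  have hpos : 0 < √5 := by positivity
  rw [div_lt_iff₀ hpos] at h1 h2 h3
  have h52 : 2 < √5 := by nlinarith
  generalize √5 = r at *
  -- Failure of the first two bounds forces `d/b` strictly between `(√5 - 1)/2` and `(√5 + 1)/2`.
  have hA : b ^ 2 + d ^ 2 < r * (b * d) := by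
    have e1 := mul_lt_mul_of_pos_left h1 (pow_pos hd 2)
    have e2 := mul_lt_mul_of_pos_left h2 (pow_pos hb 2)
    have : r * (b * d) * (d * x + b * y) = d ^ 2 * (b * x * r) + b ^ 2 * (d * y * r) := by ring
    rw [h, mul_one] at this
    linarith
  have hX : 0 < d * x := mul_pos hd hx
  have hY : 0 < b * y := mul_pos hb hy
  -- Replacing 1 by `d x + b y` makes the last two bounds homogeneous in `d x` and `b y`;
  -- eliminating these leaves an inequality in `b` and `d` alone.
  have h2' : b * (d * x) < (b * y) * (r * d - b) := by
    have := mul_lt_mul_of_pos_left h2 hb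
    rw [← h] at this
    linarith
  have h3' : (b * y) * (d * (b + r * (b + d))) < b * (d * x) * (r * (b + d) - d) := by
    have := mul_lt_mul_of_pos_left h3 (mul_pos hb hd)
    rw [← h] at this
    linarith
  have hc : 0 < r * (b + d) - d := by nlinarith
  have h4 := h3'.trans (mul_lt_mul_of_pos_right h2' hc)
  rw [mul_assoc (b * y)] at h4
  have h6 := lt_of_mul_lt_mul_left h4 hY.le
  have h7 : (r + 2) * b ^ 2 < d ^ 2 + b * d := by
    have h8 : r * b ^ 2 < (5 - 2 * r) * (d ^ 2 + b * d) := by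
      linear_combination h6 + (b*d + d ^ 2) * h5
    have h9 := mul_lt_mul_of_pos_left h8 (by linarith : 0 < r + 2)
    have h10 : (r + 2) * ((5 - 2 * r) * (d ^ 2 + b * d)) = r * (d ^ 2 + b * d) := by
      linear_combination -2 * (d ^ 2 + b * d) * h5
    rw [h10] at h9
    nlinarith
  -- This is `d/b > (√5 + 1)/2`, which contradicts `hA`; the product in `h13` is the factorization
  -- of `hA`.
  have h11 : (r + 1) * b < 2 * d := by
    have : (r + 3) * b ^ 2 < (r + 1) * (b * d) := by linarith
    have h12 : (r + 3) * b < (r + 1) * d := by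
      refine lt_of_mul_lt_mul_left (a := b) ?_ hb.le
      linarith
    nlinarith
  have h13 : (2 * d - (r + 1) * b) * (2 * d - (r - 1) * b) < 0 := by
    linear_combination 4 * hA + b ^ 2 * h5
  nlinarith [mul_pos (sub_pos.2 h11) (show 0 < 2 * d - (r - 1) * b by nlinarith)]

lemma abs_sign_mul {e : ℤ} (he : e = 1 ∨ e = -1) (z : ℝ) : |(e : ℝ) * z| = |z| := by
  rcases he with rfl | rfl <;> simp

/-- Hurwitz's theorem on Diophantine approximation. -/
lemma exists_hurwitz_approximation {ξ : ℝ} (hξ : Irrational ξ) {ε : ℝ} (hε : 0 < ε) :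
    ∃ q p : ℤ, 0 < q ∧ |q * ξ - p| < ε ∧ q * |q * ξ - p| ≤ 1 / √5 := by
  obtain ⟨e, a, b, c, d, x, y, he, hb, hd, hdet, hx, hy, hy0, hyx, hxε, hbx, hone⟩ :=
    exists_unimodular_pair hξ hε
  have hx0 := hy0.trans hyx
  have h1 : |(b : ℝ) * ξ - a| = x := by rw [hx, abs_sign_mul he, abs_of_pos hx0]
  have h2 : |(d : ℝ) * ξ - c| = y := by rw [hy, abs_neg, abs_sign_mul he, abs_of_pos hy0]
  have h3 : |((b + d : ℤ) : ℝ) * ξ - (a + c : ℤ)| = x - y := by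
    rw [show ((b + d : ℤ) : ℝ) * ξ - (a + c : ℤ) = e * (x - y) by
      push_cast; linear_combination hx + hy, abs_sign_mul he, abs_of_pos (sub_pos.2 hyx)]
  rcases farey_triple_le (Int.cast_pos.2 hb) (Int.cast_pos.2 hd) hx0 hy0 hone with h | h | h
  · exact ⟨b, a, hb, by rwa [h1], by rwa [h1]⟩
  · exact ⟨d, c, hd, by rw [h2]; linarith, by rwa [h2]⟩
  · exact ⟨b + d, a + c, by omega, by rw [h3]; linarith, by rw [h3]; exact_mod_cast h⟩

/-- Approximation of an irrational number by fractions with odd numerator and even denominator. -/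
lemma exists_odd_div_even_approximation {ξ : ℝ} (hξ : Irrational ξ) {ε : ℝ} (hε : 0 < ε) :
    ∃ q p : ℤ, 0 < q ∧ Even q ∧ Odd p ∧ |q * ξ - p| < ε ∧ q * |q * ξ - p| ≤ 1 := by
  obtain ⟨e, a, b, c, d, x, y, he, hb, hd, hdet, hx, hy, hy0, hyx, hxε, hbx, hone⟩ :=
    -- Halving makes `x + y` small enough for the difference of the two vectors as well; `x + y < 1`
    -- later rules out `b = d`.
    exists_unimodular_pair hξ (ε := min ε 1 / 2) (by positivity)
  have hx0 := hy0.trans hyx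
  have hbR : (0 : ℝ) < b := Int.cast_pos.2 hb
  have hdR : (0 : ℝ) < d := Int.cast_pos.2 hd
  have hxy : x + y < min ε 1 := by linarith
  have hε1 := hxy.trans_le (min_le_left _ _)
  have hxy1 := hxy.trans_le (min_le_right _ _)
  have h1 : |(b : ℝ) * ξ - a| = x := by rw [hx, abs_sign_mul he, abs_of_pos hx0]
  have h2 : |(d : ℝ) * ξ - c| = y := by rw [hy, abs_neg, abs_sign_mul he, abs_of_pos hy0]
  have hdx : 0 < d * x := mul_pos hdR hx0
  have hby : 0 < b * y := mul_pos hbR hy0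
  have hdyx : d * y < d * x := mul_lt_mul_of_pos_left hyx hdR
  -- Since the determinant is odd, the vectors form a basis modulo 2, so one of `a/b`, `c/d` and the
  -- mediant has the type odd/even. If it is the mediant and its bound fails, the difference has the
  -- same type and satisfies the bound.
  have hodd : ¬ Even (b * c - a * d) := by
    rw [hdet]
    rcases he with rfl | rfl <;> decide
  simp only [Int.even_sub, Int.even_mul] at hodd
  by_cases hbe : Even b
  · exact ⟨b, a, hb, hbe, by rw [← Int.not_even_iff_odd]; tauto, by rw [h1]; linarith,
      by rw [h1]; exact hbx.le⟩
  by_cases hde : Even d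
  · exact ⟨d, c, hd, hde, by rw [← Int.not_even_iff_odd]; tauto, by rw [h2]; linarith,
      by rw [h2]; linarith⟩
  by_cases hsum : (b + d) * (x - y) ≤ 1
  · have h3 : |((b + d : ℤ) : ℝ) * ξ - (a + c : ℤ)| = x - y := by
      rw [show ((b + d : ℤ) : ℝ) * ξ - (a + c : ℤ) = e * (x - y) by
        push_cast; linear_combination hx + hy, abs_sign_mul he, abs_of_pos (sub_pos.2 hyx)]
    refine ⟨b + d, a + c, by omega, by rw [Int.even_add]; tauto, ?_, by rw [h3]; linarith,
      by rw [h3]; exact_mod_cast hsum⟩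
    rw [← Int.not_even_iff_odd, Int.even_add]
    tauto
  rw [not_le] at hsum
  have hca : Odd (c - a) := by
    rw [← Int.not_even_iff_odd, Int.even_sub]
    tauto
  rcases lt_trichotomy b d with hlt | rfl | hgt
  · have h3 : |((d - b : ℤ) : ℝ) * ξ - (c - a : ℤ)| = x + y := by
      rw [show ((d - b : ℤ) : ℝ) * ξ - (c - a : ℤ) = e * (-(x + y)) by
        push_cast; linear_combination hy - hx, abs_sign_mul he, abs_neg, abs_of_pos (by linarith)]
    refine ⟨d - b, c - a, by omega, by rw [Int.even_sub]; tauto, hca, by rwa [h3], ?_⟩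
    rw [h3]
    push_cast
    linarith
  · exfalso
    have hdvd : b ∣ e := ⟨c - a, by linarith⟩
    have hb1 : b = 1 := by
      have : b ∣ 1 := by rcases he with rfl | rfl <;> simpa using hdvd
      exact Int.eq_one_of_dvd_one hb.le this
    rw [hb1] at hone
    push_cast at hone
    linarith
  · have h3 : |((b - d : ℤ) : ℝ) * ξ - (a - c : ℤ)| = x + y := by
      rw [show ((b - d : ℤ) : ℝ) * ξ - (a - c : ℤ) = e * (x + y) by
        push_cast; linear_combination hx - hy, abs_sign_mul he, abs_of_pos (by linarith)]
    refine ⟨b - d, a - c, by omega, by rw [Int.even_sub]; tauto, ?_, by rwa [h3], ?_⟩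
    · rw [← neg_sub]
      exact hca.neg
    rw [h3]
    push_cast
    linarith [mul_pos hdR hy0]

/-- The finitely many multiples `ξ, …, Nξ` have positive distance from `ℤ`. This turns good
approximation into large denominators. -/
lemma exists_pos_le_abs_mul_sub {ξ : ℝ} (hξ : Irrational ξ) (N : ℕ) :
    ∃ δ > 0, ∀ q p : ℤ, 0 < q → |q * ξ - p| < δ → (N : ℤ) < q := by
  induction N with
  | zero => exact ⟨1, one_pos, fun q p hq _ => by simpa using hq⟩
  | succ N ih =>
    obtain ⟨δ, hδ, h⟩ := ih
    set z := ((N + 1 : ℤ) : ℝ) * ξ with hz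
    have hirr : Irrational z := hξ.intCast_mul (by omega)
    refine ⟨min δ |z - round z|, lt_min hδ (abs_pos.2 (hirr.sub_intCast _).ne_zero),
      fun q p hq hlt => ?_⟩
    have h1 := h q p hq (hlt.trans_le (min_le_left _ _))
    have h2 : q ≠ N + 1 := by
      rintro rfl
      exact absurd (hlt.trans_le (min_le_right _ _)) (not_lt.2 (round_le z p))
    push_cast
    omega

/-! ### Monotonicity, continuity and limits of `K` and `S` -/

lemma one_div_sqrt_two_pos : 0 < 1 / √(2 : ℝ) := by positivity

lemma one_div_sqrt_two_sq : (1 / √(2 : ℝ)) ^ 2 = 1 / 2 := by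
  rw [div_pow, Real.sq_sqrt (by norm_num), one_pow]

lemma one_div_sqrt_two_lt_one : 1 / √(2 : ℝ) < 1 := by
  nlinarith [one_div_sqrt_two_sq, one_div_sqrt_two_pos]

lemma half_le_sq_of_mem {k : ℝ} (hk : k ∈ Ico (1 / √2) 1) : 1 / 2 ≤ k ^ 2 := by
  rw [← one_div_sqrt_two_sq]
  exact pow_le_pow_left₀ one_div_sqrt_two_pos.le hk.1 2

lemma half_lt_sq_of_mem {k : ℝ} (hk : k ∈ Ioo (1 / √2) 1) : 1 / 2 < k ^ 2 := by
  rw [← one_div_sqrt_two_sq]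
  exact pow_lt_pow_left₀ hk.1 one_div_sqrt_two_pos.le (by norm_num)

lemma pos_of_mem {k : ℝ} (hk : k ∈ Ico (1 / √2) 1) : 0 < k :=
  one_div_sqrt_two_pos.trans_le hk.1

lemma sq_lt_one_of_mem {k : ℝ} (hk : k ∈ Ico (1 / √2) 1) : k ^ 2 < 1 := by
  nlinarith [pos_of_mem hk, hk.2]

lemma ellipticK_pos {k : ℝ} (hk : k ^ 2 < 1) : 0 < ellipticK k :=
  (div_pos Real.pi_pos two_pos).trans_le (le_ellipticF hk (by positivity))

lemma strictMonoOn_ellipticK : StrictMonoOn ellipticK (Ico 0 1) := by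
  intro k hk l hl hkl
  have hk1 : k ^ 2 < 1 := by nlinarith [hk.1, hk.2]
  have hl1 : l ^ 2 < 1 := by nlinarith [hl.1, hl.2]
  have hsq : k ^ 2 < l ^ 2 := pow_lt_pow_left₀ hkl hk.1 (by norm_num)
  refine intervalIntegral.integral_lt_integral_of_continuousOn_of_le_of_exists_lt
    (by positivity) (continuous_ellipticF_integrand hk1).continuousOn
    (continuous_ellipticF_integrand hl1).continuousOn (fun s _ => ?_)
    ⟨Real.pi / 2, ⟨by positivity, le_rfl⟩, ?_⟩
  · have := Real.sqrt_pos.2 (one_sub_sq_mul_sin_sq_pos hl1 s)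
    gcongr
  · have := Real.sqrt_pos.2 (one_sub_sq_mul_sin_sq_pos hl1 (Real.pi / 2))
    simp only [Real.sin_pi_div_two, one_pow, mul_one] at this ⊢
    have h0 : 0 ≤ 1 - l ^ 2 := by linarith
    gcongr

lemma continuousOn_ellipticF_comp {φ : ℝ → ℝ} (hφ : Continuous φ) :
    ContinuousOn (fun k => ellipticF k (φ k)) (Ioo (-1) 1) := by
  intro k hk
  obtain ⟨c, hc, hc1⟩ := exists_between (abs_lt.2 hk)
  have hcont : Continuous fun l => ∫ s in (0 : ℝ)..φ l,
      -- The cutoff makes the integrand continuous for all `l` and changes nothing when `|l| < c`.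
      1 / √(max (1 - l ^ 2 * Real.sin s ^ 2) (1 - c ^ 2)) := by
    have hpos : 0 < 1 - c ^ 2 := by nlinarith [abs_nonneg k]
    refine intervalIntegral.continuous_parametric_intervalIntegral_of_continuous ?_ hφ
    refine Continuous.div (by fun_prop) (by fun_prop) fun s => ?_
    exact (Real.sqrt_pos.2 (hpos.trans_le (le_max_right _ _))).ne'
  refine (hcont.continuousAt.congr ?_).continuousWithinAt
  have hev : ∀ᶠ l in 𝓝 k, |l| < c := (continuous_abs.tendsto k).eventually (gt_mem_nhds hc)
  filter_upwards [hev] with l hl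
  have hl2 : l ^ 2 ≤ c ^ 2 := by
    rw [← sq_abs l]
    exact pow_le_pow_left₀ (abs_nonneg l) hl.le 2
  refine intervalIntegral.integral_congr fun s _ => ?_
  rw [max_eq_left]
  have := mul_le_of_le_one_right (sq_nonneg l) (Real.sin_sq_le_one s)
  linarith

lemma continuousOn_ellipticK : ContinuousOn ellipticK (Ioo (-1) 1) :=
  continuousOn_ellipticF_comp continuous_const

/-- With `q = √(1 - k²)`, the bound `cos s ≤ π/2 - s` gives `1 - k² sin² s = cos² s + q² sin² s ≤
(π/2 - s + q)²`, and the comparison integral is elementary. It makes `K` diverge at 1. -/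
lemma log_le_ellipticK {k : ℝ} (hk : k ^ 2 < 1) :
    Real.log ((Real.pi / 2 + √(1 - k ^ 2)) / √(1 - k ^ 2)) ≤ ellipticK k := by
  set q := √(1 - k ^ 2) with hq
  have hq0 : 0 < q := Real.sqrt_pos.2 (by linarith)
  have hq2 : q ^ 2 = 1 - k ^ 2 := Real.sq_sqrt (by linarith)
  have hpi : 0 < Real.pi / 2 := by positivity
  have hint : ∫ s in (0 : ℝ)..(Real.pi / 2), 1 / (Real.pi / 2 + q - s) =
      Real.log ((Real.pi / 2 + q) / q) := by
    rw [intervalIntegral.integral_comp_sub_left (fun t => 1 / t) (Real.pi / 2 + q)]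
    rw [integral_one_div_of_pos (by linarith) (by linarith)]
    simp
  rw [← hint]
  refine intervalIntegral.integral_mono_on hpi.le ?_
    ((continuous_ellipticF_integrand hk).intervalIntegrable _ _) fun s hs => ?_
  · refine ContinuousOn.intervalIntegrable fun s hs => ?_
    rw [uIcc_of_le hpi.le] at hs
    exact ContinuousAt.continuousWithinAt
      (ContinuousAt.div (by fun_prop) (by fun_prop) (by linarith [hs.2]))
  · refine one_div_le_one_div_of_le (Real.sqrt_pos.2 (one_sub_sq_mul_sin_sq_pos hk s)) ?_
    rw [Real.sqrt_le_left (by linarith [hs.2])]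
    have hcos : Real.cos s ≤ Real.pi / 2 - s := by
      rw [← Real.sin_pi_div_two_sub]
      exact Real.sin_le (by linarith [hs.2])
    have hcos0 : 0 ≤ Real.cos s := Real.cos_nonneg_of_mem_Icc ⟨by linarith [hs.1], hs.2⟩
    have hsin := Real.sin_sq_add_cos_sq s
    have hsin1 := Real.sin_sq_le_one s
    have h1 : 1 - k ^ 2 * Real.sin s ^ 2 = Real.cos s ^ 2 + q ^ 2 * Real.sin s ^ 2 := by
      rw [hq2]; linarith
    have h2 : Real.cos s ^ 2 ≤ (Real.pi / 2 - s) ^ 2 := pow_le_pow_left₀ hcos0 hcos 2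
    have h3 : q ^ 2 * Real.sin s ^ 2 ≤ q ^ 2 := mul_le_of_le_one_right (sq_nonneg q) hsin1
    nlinarith [mul_nonneg hq0.le (show 0 ≤ Real.pi / 2 - s by linarith [hs.2])]

lemma tendsto_ellipticK : Tendsto ellipticK (𝓝[<] 1) atTop := by
  have hev : ∀ᶠ k : ℝ in 𝓝[<] 1, k ∈ Ioo (0 : ℝ) 1 := Ioo_mem_nhdsLT one_pos
  have hsqrt : Tendsto (fun k : ℝ => √(1 - k ^ 2)) (𝓝[<] 1) (𝓝[>] 0) := by
    refine tendsto_nhdsWithin_iff.2 ⟨?_, ?_⟩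
    · have : Continuous fun k : ℝ => √(1 - k ^ 2) := by fun_prop
      have h := (this.tendsto 1).mono_left (nhdsWithin_le_nhds (s := Iio 1))
      simpa using h
    · filter_upwards [hev] with k hk
      exact Real.sqrt_pos.2 (by nlinarith [hk.1, hk.2])
  have hdiv : Tendsto (fun k : ℝ => (Real.pi / 2 + √(1 - k ^ 2)) / √(1 - k ^ 2)) (𝓝[<] 1)
      atTop := by
    have hinv : Tendsto (fun k : ℝ => Real.pi / 2 * (√(1 - k ^ 2))⁻¹) (𝓝[<] 1) atTop :=
      (tendsto_inv_nhdsGT_zero.comp hsqrt).const_mul_atTop (by positivity)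
    refine tendsto_atTop_mono' _ ?_ hinv
    filter_upwards with k
    rw [← div_eq_mul_inv]
    gcongr
    linarith [Real.sqrt_nonneg (1 - k ^ 2)]
  refine tendsto_atTop_mono' _ ?_ (Real.tendsto_log_atTop.comp hdiv)
  filter_upwards [hev] with k hk
  exact log_le_ellipticK (by nlinarith [hk.1, hk.2])

lemma periodS_pos {k : ℝ} (hk : k ∈ Ioo (1 / √2) 1) : 0 < periodS k := by
  have h := half_lt_sq_of_mem hk
  have h1 := ellipticK_pos (sq_lt_one_of_mem (Ioo_subset_Ico_self hk))
  have h2 : 0 < √(2 * k ^ 2 - 1) := Real.sqrt_pos.2 (by linarith)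
  rw [periodS]
  positivity

lemma strictMonoOn_periodS : StrictMonoOn periodS (Ico (1 / √2) 1) := by
  intro k hk l hl hkl
  have hK := strictMonoOn_ellipticK ⟨(pos_of_mem hk).le, hk.2⟩ ⟨(pos_of_mem hl).le, hl.2⟩ hkl
  have hK0 := ellipticK_pos (sq_lt_one_of_mem hk)
  have hsq : k ^ 2 < l ^ 2 := pow_lt_pow_left₀ hkl (pos_of_mem hk).le (by norm_num)
  have hs : √(2 * k ^ 2 - 1) < √(2 * l ^ 2 - 1) :=
    Real.sqrt_lt_sqrt (by linarith [half_le_sq_of_mem hk]) (by linarith)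
  rw [periodS, periodS]
  exact mul_lt_mul'' (by linarith) hK (by positivity) hK0.le

lemma Ico_subset_Ioo_neg_one : Ico (1 / √2) (1 : ℝ) ⊆ Ioo (-1) 1 := fun _ hk =>
  ⟨by linarith [pos_of_mem hk], hk.2⟩

lemma continuousOn_periodS : ContinuousOn periodS (Ico (1 / √2) 1) :=
  (Continuous.continuousOn (by fun_prop)).mul
    (continuousOn_ellipticK.mono Ico_subset_Ioo_neg_one)

lemma eventually_mem_Ioo : ∀ᶠ k : ℝ in 𝓝[<] 1, k ∈ Ioo (1 / √2) (1 : ℝ) :=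
  Ioo_mem_nhdsLT one_div_sqrt_two_lt_one

lemma surjOn_periodS : SurjOn periodS (Ioo (1 / √2) 1) (Ioi 0) := by
  intro y hy
  have hlim : Tendsto periodS (𝓝[<] 1) atTop := by
    have h1 : Tendsto (fun k : ℝ => 4 * √(2 * k ^ 2 - 1)) (𝓝[<] 1) (𝓝 4) := by
      have : Continuous fun k : ℝ => 4 * √(2 * k ^ 2 - 1) := by fun_prop
      have h := (this.tendsto 1).mono_left (nhdsWithin_le_nhds (s := Iio 1))
      norm_num at h
      exact h
    exact h1.pos_mul_atTop (by norm_num) tendsto_ellipticK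
  obtain ⟨c, hc, hcy⟩ := (eventually_mem_Ioo.and (hlim.eventually_ge_atTop y)).exists
  have h0 : periodS (1 / √2) = 0 := by
    rw [periodS, one_div_sqrt_two_sq]
    norm_num
  have hsub : Icc (1 / √2) c ⊆ Ico (1 / √2) 1 := fun k hk => ⟨hk.1, hk.2.trans_lt hc.2⟩
  obtain ⟨k, hk, rfl⟩ := intermediate_value_Icc hc.1.le (continuousOn_periodS.mono hsub)
    ⟨h0.le.trans (le_of_lt hy), hcy⟩
  refine ⟨k, ⟨hk.1.lt_of_ne fun h => ?_, (hsub hk).2⟩, rfl⟩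
  rw [← h, h0] at hy
  exact lt_irrefl (0 : ℝ) hy

/-! ### The matching ratio and its inverse -/

/-- The angle `φ ∈ [0, π/2]` with `cos φ = √(2k² - 1) / k`. -/
noncomputable def matchAngle (k : ℝ) : ℝ := Real.arccos (√(2 * k ^ 2 - 1) / k)

/-- The ratio `F(φ; k) / K(k)` at the matching angle. -/
noncomputable def matchRatio (k : ℝ) : ℝ := ellipticF k (matchAngle k) / ellipticK k

lemma sqrt_div_mem_Icc {k : ℝ} (hk : k ∈ Ico (1 / √2) 1) :
    √(2 * k ^ 2 - 1) / k ∈ Icc (0 : ℝ) 1 := by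
  have hpos := pos_of_mem hk
  refine ⟨by positivity, ?_⟩
  rw [div_le_one hpos, Real.sqrt_le_left hpos.le]
  linarith [sq_lt_one_of_mem hk]

lemma cos_matchAngle {k : ℝ} (hk : k ∈ Ico (1 / √2) 1) :
    Real.cos (matchAngle k) = √(2 * k ^ 2 - 1) / k :=
  Real.cos_arccos (by linarith [(sqrt_div_mem_Icc hk).1]) (sqrt_div_mem_Icc hk).2

lemma matchAngle_mem {k : ℝ} (hk : k ∈ Ico (1 / √2) 1) : matchAngle k ∈ Icc 0 (Real.pi / 2) :=
  ⟨Real.arccos_nonneg _, Real.arccos_le_pi_div_two.2 (sqrt_div_mem_Icc hk).1⟩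

lemma sin_matchAngle {k : ℝ} (hk : k ∈ Ico (1 / √2) 1) :
    Real.sin (matchAngle k) = √(1 - k ^ 2) / k := by
  have hpos := pos_of_mem hk
  have h1 := half_le_sq_of_mem hk
  rw [matchAngle, Real.sin_arccos, div_pow, Real.sq_sqrt (by linarith),
    show 1 - (2 * k ^ 2 - 1) / k ^ 2 = (1 - k ^ 2) / k ^ 2 by field_simp; ring,
    Real.sqrt_div (by linarith [sq_lt_one_of_mem hk]), Real.sqrt_sq hpos.le]

lemma matchAngle_pos {k : ℝ} (hk : k ∈ Ico (1 / √2) 1) : 0 < matchAngle k := by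
  refine (matchAngle_mem hk).1.lt_of_ne fun h => ?_
  have := sin_matchAngle hk
  rw [← h, Real.sin_zero] at this
  have h1 : 0 < √(1 - k ^ 2) := Real.sqrt_pos.2 (by linarith [sq_lt_one_of_mem hk])
  exact (div_pos h1 (pos_of_mem hk)).ne this

/-- The substitution `sin s = (√(1 - k²) / k) t` in `F(φ; k)`. -/
lemma ellipticF_matchAngle {k : ℝ} (hk : k ∈ Ioo (1 / √2) 1) :
    ellipticF k (matchAngle k) = ∫ t in (0 : ℝ)..1,
      √(1 / k ^ 2 - 1) / (√(1 - (1 / k ^ 2 - 1) * t ^ 2) * √(1 - (1 - k ^ 2) * t ^ 2)) := by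
  have hk' := Ioo_subset_Ico_self hk
  have hpos := pos_of_mem hk'
  have h1 := half_lt_sq_of_mem hk
  have h2 := sq_lt_one_of_mem hk'
  set l := √(1 / k ^ 2 - 1) with hl
  have hl2 : l ^ 2 = 1 / k ^ 2 - 1 := by
    refine Real.sq_sqrt ?_
    rw [sub_nonneg, le_div_iff₀ (by positivity)]
    linarith
  have hl0 : 0 ≤ l := Real.sqrt_nonneg _
  have hl1 : l < 1 := by
    have : l ^ 2 < 1 := by
      rw [hl2, sub_lt_iff_lt_add, div_lt_iff₀ (by positivity)]
      linarith
    nlinarith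
  have hsin : Real.sin (matchAngle k) = l := by
    rw [sin_matchAngle hk', hl, show 1 / k ^ 2 - 1 = (1 - k ^ 2) / k ^ 2 by field_simp,
      Real.sqrt_div (by linarith), Real.sqrt_sq hpos.le]
  have harc : Real.arcsin l = matchAngle k := by
    rw [← hsin]
    have := matchAngle_mem hk'
    exact Real.arcsin_sin (by linarith [this.1, Real.pi_pos]) this.2
  have hlt : ∀ t ∈ uIcc (0 : ℝ) 1, l * t ∈ Ico (0 : ℝ) 1 := fun t ht => by
    rw [uIcc_of_le zero_le_one] at ht
    exact ⟨mul_nonneg hl0 ht.1, (mul_le_of_le_one_right hl0 ht.2).trans_lt hl1⟩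
  have hsub := intervalIntegral.integral_comp_mul_deriv (a := 0) (b := 1)
    (f := fun t => Real.arcsin (l * t)) (f' := fun t => 1 / √(1 - (l * t) ^ 2) * l)
    (g := fun s => 1 / √(1 - k ^ 2 * Real.sin s ^ 2))
    (fun t ht => by
      have := hlt t ht
      have hd := (Real.hasDerivAt_arcsin (x := l * t) (by linarith [this.1]) this.2.ne)
      simpa [Function.comp_def] using hd.comp t ((hasDerivAt_id t).const_mul l))
    (fun t ht => by
      have := hlt t ht
      have hp : 0 < 1 - (l * t) ^ 2 := by nlinarith [this.1, this.2]
      refine ContinuousAt.continuousWithinAt (ContinuousAt.mul ?_ continuousAt_const)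
      exact ContinuousAt.div (by fun_prop) (by fun_prop) (Real.sqrt_pos.2 hp).ne')
    (continuous_ellipticF_integrand h2)
  simp only [mul_zero, mul_one, Real.arcsin_zero, harc] at hsub
  rw [ellipticF, ← hsub]
  refine intervalIntegral.integral_congr fun t ht => ?_
  have := hlt t ht
  simp only [Function.comp]
  rw [Real.sin_arcsin (by linarith [this.1]) this.2.le, mul_pow, hl2,
    show k ^ 2 * ((1 / k ^ 2 - 1) * t ^ 2) = (1 - k ^ 2) * t ^ 2 by field_simp]
  field_simp

/-- After the substitution the interval no longer depends on `k`, and the integrand decreases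
pointwise in `k`. -/
lemma antitoneOn_ellipticF_matchAngle :
    AntitoneOn (fun k => ellipticF k (matchAngle k)) (Ioo (1 / √2) 1) := by
  intro k hk l hl hkl
  simp only
  rw [ellipticF_matchAngle hk, ellipticF_matchAngle hl]
  have key : ∀ k ∈ Ioo (1 / √2) (1 : ℝ), ∀ t ∈ Icc (0 : ℝ) 1,
      0 < 1 - (1 / k ^ 2 - 1) * t ^ 2 ∧ 0 < 1 - (1 - k ^ 2) * t ^ 2 := fun k hk t ht => by
    have h1 := half_lt_sq_of_mem hk
    have h2 := sq_lt_one_of_mem (Ioo_subset_Ico_self hk)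
    have h3 : 1 / k ^ 2 - 1 < 1 := by
      rw [sub_lt_iff_lt_add, div_lt_iff₀ (by linarith)]
      linarith
    have h4 : 0 ≤ 1 / k ^ 2 - 1 := by
      rw [sub_nonneg, le_div_iff₀ (by linarith)]
      linarith
    have ht2 : t ^ 2 ≤ 1 := pow_le_one₀ ht.1 ht.2
    exact ⟨by linarith [mul_le_of_le_one_right h4 ht2],
      by linarith [mul_le_of_le_one_right (sub_nonneg.2 h2.le) ht2]⟩
  have hint : ∀ k ∈ Ioo (1 / √2) (1 : ℝ), IntervalIntegrable (fun t =>
      √(1 / k ^ 2 - 1) / (√(1 - (1 / k ^ 2 - 1) * t ^ 2) * √(1 - (1 - k ^ 2) * t ^ 2)))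
      volume 0 1 := fun k hk => by
    refine ContinuousOn.intervalIntegrable fun t ht => ?_
    rw [uIcc_of_le zero_le_one] at ht
    obtain ⟨h1, h2⟩ := key k hk t ht
    refine ContinuousAt.continuousWithinAt (ContinuousAt.div (by fun_prop) (by fun_prop) ?_)
    exact (mul_pos (Real.sqrt_pos.2 h1) (Real.sqrt_pos.2 h2)).ne'
  refine intervalIntegral.integral_mono_on zero_le_one (hint l hl) (hint k hk) fun t ht => ?_
  obtain ⟨h1, h2⟩ := key k hk t ht
  have hkpos := pos_of_mem (Ioo_subset_Ico_self hk)
  have h3 := Real.sqrt_pos.2 h1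
  have h4 := Real.sqrt_pos.2 h2
  gcongr

lemma strictAntiOn_matchRatio : StrictAntiOn matchRatio (Ioo (1 / √2) 1) := by
  intro k hk l hl hkl
  have hk' := Ioo_subset_Ico_self hk
  have hl' := Ioo_subset_Ico_self hl
  have hK := strictMonoOn_ellipticK ⟨(pos_of_mem hk').le, hk.2⟩ ⟨(pos_of_mem hl').le, hl.2⟩ hkl
  have hF : 0 < ellipticF l (matchAngle l) :=
    (matchAngle_pos hl').trans_le
      (le_ellipticF (sq_lt_one_of_mem hl') (matchAngle_pos hl').le)
  have hFkl := antitoneOn_ellipticF_matchAngle hk hl hkl.le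
  have := ellipticK_pos (sq_lt_one_of_mem hk')
  exact div_lt_div₀' hFkl hK (hF.trans_le hFkl) this

lemma continuousOn_matchRatio : ContinuousOn matchRatio (Ico (1 / √2) 1) := by
  -- The maximum keeps the denominator away from 0, so this extension of the angle is continuous on
  -- all of `ℝ`.
  set φ : ℝ → ℝ := fun k => Real.arccos (√(2 * k ^ 2 - 1) / max k (1 / √2)) with hφ
  have hcont : Continuous φ := by
    refine Real.continuous_arccos.comp (Continuous.div (by fun_prop) (by fun_prop) fun k => ?_)
    exact (one_div_sqrt_two_pos.trans_le (le_max_right _ _)).ne'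
  refine ContinuousOn.div ?_ (continuousOn_ellipticK.mono Ico_subset_Ioo_neg_one)
    fun k hk => (ellipticK_pos (sq_lt_one_of_mem hk)).ne'
  refine ((continuousOn_ellipticF_comp hcont).mono Ico_subset_Ioo_neg_one).congr fun k hk => ?_
  simp only [hφ, matchAngle, max_eq_left hk.1]

lemma matchRatio_one_div_sqrt_two : matchRatio (1 / √2) = 1 := by
  have h : matchAngle (1 / √2) = Real.pi / 2 := by
    rw [matchAngle, one_div_sqrt_two_sq]
    norm_num
  rw [matchRatio, h]
  refine div_self (ellipticK_pos ?_).ne'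
  rw [one_div_sqrt_two_sq]
  norm_num

lemma tendsto_matchRatio : Tendsto matchRatio (𝓝[<] 1) (𝓝 0) := by
  obtain ⟨c, hc⟩ := exists_between one_div_sqrt_two_lt_one
  have hlim : Tendsto (fun k => ellipticF c (matchAngle c) / ellipticK k) (𝓝[<] 1) (𝓝 0) :=
    tendsto_ellipticK.const_div_atTop _
  refine tendsto_of_tendsto_of_tendsto_of_le_of_le' tendsto_const_nhds hlim ?_ ?_
  · filter_upwards [eventually_mem_Ioo] with k hk
    have hk' := Ioo_subset_Ico_self hk
    have := le_ellipticF (sq_lt_one_of_mem hk') (matchAngle_pos hk').le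
    exact div_nonneg ((matchAngle_pos hk').le.trans this)
      (ellipticK_pos (sq_lt_one_of_mem hk')).le
  · filter_upwards [eventually_mem_Ioo, Ioo_mem_nhdsLT hc.2] with k hk hck
    have := ellipticK_pos (sq_lt_one_of_mem (Ioo_subset_Ico_self hk))
    exact div_le_div_of_nonneg_right (antitoneOn_ellipticF_matchAngle hc hk hck.1.le) this.le

lemma exists_matchRatio_eq {θ : ℝ} (hθ : θ ∈ Ioo (0 : ℝ) 1) :
    ∃ k ∈ Ioo (1 / √2) 1, matchRatio k = θ := by
  obtain ⟨c, hc, hcy⟩ :=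
    (eventually_mem_Ioo.and (tendsto_matchRatio.eventually (gt_mem_nhds hθ.1))).exists
  have hsub : Icc (1 / √2) c ⊆ Ico (1 / √2) 1 := fun k hk => ⟨hk.1, hk.2.trans_lt hc.2⟩
  obtain ⟨k, hk, hkθ⟩ := intermediate_value_Icc' hc.1.le (continuousOn_matchRatio.mono hsub)
    ⟨hcy.le, hθ.2.le.trans_eq matchRatio_one_div_sqrt_two.symm⟩
  refine ⟨k, ⟨hk.1.lt_of_ne fun h => ?_, (hsub hk).2⟩, hkθ⟩
  rw [← h, matchRatio_one_div_sqrt_two] at hkθ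
  exact hθ.2.ne hkθ.symm

/-- The modulus at which `matchRatio` takes the value `θ`. -/
noncomputable def matchModulus (θ : ℝ) : ℝ := Function.invFunOn matchRatio (Ioo (1 / √2) 1) θ

lemma matchModulus_mem {θ : ℝ} (hθ : θ ∈ Ioo (0 : ℝ) 1) : matchModulus θ ∈ Ioo (1 / √2) 1 :=
  Function.invFunOn_mem (exists_matchRatio_eq hθ)

lemma matchRatio_matchModulus {θ : ℝ} (hθ : θ ∈ Ioo (0 : ℝ) 1) :
    matchRatio (matchModulus θ) = θ :=
  Function.invFunOn_eq (exists_matchRatio_eq hθ)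

lemma matchRatio_eq_iff {k θ : ℝ} (hk : k ∈ Ioo (1 / √2) 1) (hθ : θ ∈ Ioo (0 : ℝ) 1) :
    matchRatio k = θ ↔ k = matchModulus θ := by
  constructor
  · intro h
    exact strictAntiOn_matchRatio.injOn hk (matchModulus_mem hθ)
      (h.trans (matchRatio_matchModulus hθ).symm)
  · rintro rfl
    exact matchRatio_matchModulus hθ

lemma strictAntiOn_matchModulus : StrictAntiOn matchModulus (Ioo 0 1) := by
  intro θ hθ η hη h
  rwa [← strictAntiOn_matchRatio.lt_iff_gt (matchModulus_mem hθ) (matchModulus_mem hη),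
    matchRatio_matchModulus hθ, matchRatio_matchModulus hη]

/-- On `[φ, π/2]` one has `sin s ≥ √(1 - k²)/k`, so the integrand of `F` is at least `1/k`; and `cos
φ ≤ π/2 - φ`. Together `√(2k² - 1)/k ≤ π/2 - φ ≤ k (K - F(φ))`. -/
lemma periodS_le {k : ℝ} (hk : k ∈ Ioo (1 / √2) 1) :
    periodS k ≤ 4 * k ^ 2 * ellipticK k ^ 2 * (1 - matchRatio k) := by
  have hk' := Ioo_subset_Ico_self hk
  have hpos := pos_of_mem hk'
  have h2 := sq_lt_one_of_mem hk'
  have hK := ellipticK_pos h2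
  obtain ⟨hφ0, hφ1⟩ := matchAngle_mem hk'
  have hint : (Real.pi / 2 - matchAngle k) * (1 / k) ≤
      ellipticK k - ellipticF k (matchAngle k) := by
    rw [ellipticK, ellipticF_sub_eq h2]
    have : ∫ _ in matchAngle k..(Real.pi / 2), 1 / k ≤
        ∫ s in matchAngle k..(Real.pi / 2), 1 / √(1 - k ^ 2 * Real.sin s ^ 2) := by
      refine intervalIntegral.integral_mono_on hφ1 (by simp)
        ((continuous_ellipticF_integrand h2).intervalIntegrable _ _) fun s hs => ?_
      refine one_div_le_one_div_of_le (Real.sqrt_pos.2 (one_sub_sq_mul_sin_sq_pos h2 s)) ?_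
      rw [Real.sqrt_le_left hpos.le]
      have h3 : Real.sin (matchAngle k) ≤ Real.sin s :=
        Real.sin_le_sin_of_le_of_le_pi_div_two (by linarith [Real.pi_pos]) hs.2 hs.1
      rw [sin_matchAngle hk'] at h3
      have h4 := pow_le_pow_left₀ (by positivity) h3 2
      rw [div_pow, Real.sq_sqrt (by linarith), div_le_iff₀ (by positivity)] at h4
      linarith
    simpa using this
  have hcos : √(2 * k ^ 2 - 1) / k ≤ Real.pi / 2 - matchAngle k := by
    rw [← cos_matchAngle hk', ← Real.sin_pi_div_two_sub]
    exact Real.sin_le (by linarith)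
  have hle : √(2 * k ^ 2 - 1) ≤ k ^ 2 * (ellipticK k - ellipticF k (matchAngle k)) := by
    have := (mul_le_mul_of_nonneg_right hcos (one_div_pos.2 hpos).le).trans hint
    rw [div_mul_div_comm, mul_one, div_le_iff₀ (by positivity)] at this
    linarith
  have hratio : ellipticK k * (1 - matchRatio k) =
      ellipticK k - ellipticF k (matchAngle k) := by
    rw [matchRatio]
    field_simp
  calc periodS k = 4 * ellipticK k * √(2 * k ^ 2 - 1) := by rw [periodS]; ring
    _ ≤ 4 * ellipticK k * (k ^ 2 * (ellipticK k - ellipticF k (matchAngle k))) := by gcongr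
    _ = _ := by rw [← hratio]; ring

lemma tendsto_matchModulus : Tendsto matchModulus (𝓝[<] 1) (𝓝[>] (1 / √2)) := by
  have hev : ∀ᶠ θ : ℝ in 𝓝[<] 1, θ ∈ Ioo (0 : ℝ) 1 := Ioo_mem_nhdsLT one_pos
  refine tendsto_nhdsWithin_iff.2
    ⟨tendsto_order.2 ⟨fun c hc => ?_, fun c hc => ?_⟩, hev.mono fun θ h => (matchModulus_mem h).1⟩
  · filter_upwards [hev] with θ hθ
    exact hc.trans (matchModulus_mem hθ).1
  · obtain ⟨k, hk⟩ := exists_between (lt_min hc one_div_sqrt_two_lt_one)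
    have hkmem : k ∈ Ioo (1 / √2) (1 : ℝ) := ⟨hk.1, hk.2.trans_le (min_le_right _ _)⟩
    obtain ⟨l, hl⟩ := exists_between hk.1
    have hlmem : l ∈ Ioo (1 / √2) (1 : ℝ) := ⟨hl.1, hl.2.trans hkmem.2⟩
    have h1 : matchRatio k < 1 := by
      have hanti : matchRatio k < matchRatio l := strictAntiOn_matchRatio hlmem hkmem hl.2
      have hle : matchRatio l ≤ 1 := by
        have hl' := Ioo_subset_Ico_self hlmem
        rw [matchRatio, div_le_one (ellipticK_pos (sq_lt_one_of_mem hl'))]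
        exact (strictMono_ellipticF (sq_lt_one_of_mem hl')).monotone (matchAngle_mem hl').2
      exact hanti.trans_le hle
    filter_upwards [hev, Ioo_mem_nhdsLT h1] with θ hθ hkθ
    refine lt_trans ?_ (hk.2.trans_le (min_le_left _ _))
    rw [← strictAntiOn_matchRatio.lt_iff_gt hkmem (matchModulus_mem hθ),
      matchRatio_matchModulus hθ]
    exact hkθ.1

/-! ### Cnoidal waves and the matching condition -/

lemma modulus_spec {L ω : ℝ} (hL : 0 < L) (hω : ω < 0) (n : ℕ+) :
    modulus L n ω ∈ Ioo (1 / √2) 1 ∧ periodS (modulus L n ω) = L * √|ω| / n := by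
  have hn : (0 : ℝ) < n := by exact_mod_cast n.pos
  have hω' : 0 < √|ω| := Real.sqrt_pos.2 (abs_pos.2 hω.ne)
  have h : L * √|ω| / n ∈ periodS '' Ioo (1 / √2) 1 :=
    surjOn_periodS (mem_Ioi.2 (by positivity))
  exact ⟨Function.invFunOn_mem h, Function.invFunOn_eq h⟩

/-- The wave number times the length of the interval is `n` periods of `cn`. -/
lemma wave_number_mul {L ω : ℝ} (hL : 0 < L) (hω : ω < 0) (n : ℕ+) :
    √(|ω| / (2 * modulus L n ω ^ 2 - 1)) * (L / n) = 4 * ellipticK (modulus L n ω) := by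
  obtain ⟨hk, hS⟩ := modulus_spec hL hω n
  have hpos : 0 < √(2 * modulus L n ω ^ 2 - 1) :=
    Real.sqrt_pos.2 (by linarith [half_lt_sq_of_mem hk])
  rw [Real.sqrt_div (abs_nonneg _), div_mul_eq_mul_div, div_eq_iff hpos.ne']
  rw [periodS] at hS
  linear_combination -hS

lemma jacobiCn_abs {k : ℝ} (hk : k ^ 2 < 1) (y : ℝ) : jacobiCn k |y| = jacobiCn k y := by
  rcases abs_choice y with h | h <;> rw [h]
  exact jacobiCn_neg hk y

/-- Both the amplitude of `θ K` and the matching angle lie in `[0, π/2]`, where the cosine is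
injective. -/
lemma jacobiCn_eq_iff {k θ : ℝ} (hk : k ∈ Ioo (1 / √2) 1) (hθ : θ ∈ Ioo (0 : ℝ) 1) :
    jacobiCn k (θ * ellipticK k) = √(2 * k ^ 2 - 1) / k ↔ matchRatio k = θ := by
  have hk' := Ioo_subset_Ico_self hk
  have h2 := sq_lt_one_of_mem hk'
  have hK := ellipticK_pos h2
  have hφ := matchAngle_mem hk'
  have ham0 : 0 ≤ jacobiAm k (θ * ellipticK k) := by
    rw [← (strictMono_ellipticF h2).le_iff_le, ellipticF_zero, ellipticF_jacobiAm h2]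
    exact mul_nonneg hθ.1.le hK.le
  have ham1 : jacobiAm k (θ * ellipticK k) ≤ Real.pi / 2 := by
    rw [← (strictMono_ellipticF h2).le_iff_le, ellipticF_jacobiAm h2]
    exact mul_le_of_le_one_left hK.le hθ.2.le
  rw [← cos_matchAngle hk', jacobiCn, Real.injOn_cos.eq_iff
    ⟨ham0, by linarith [Real.pi_pos]⟩ ⟨hφ.1, by linarith [hφ.2, Real.pi_pos]⟩,
    ← (strictMono_ellipticF h2).injective.eq_iff, ellipticF_jacobiAm h2, matchRatio,
    div_eq_iff hK.ne', eq_comm]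

lemma isH2_of_hasDerivAt {u v w : ℝ → ℝ} {L : ℝ} (hu : ∀ x, HasDerivAt u (v x) x)
    (hv : ∀ x, HasDerivAt v (w x) x) (hw : Continuous w) : IsH2 L u v w := by
  have hvc : Continuous v := continuous_iff_continuousAt.2 fun x => (hv x).continuousAt
  refine ⟨?_, fun x _ => ?_, fun x _ => ?_⟩
  · obtain ⟨C, hC⟩ := (isCompact_Icc (a := 0) (b := L)).exists_bound_of_continuousOn hw.continuousOn
    refine MemLp.of_bound hw.aestronglyMeasurable C ?_
    exact (ae_restrict_iff' measurableSet_Icc).2 (Eventually.of_forall hC)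
  · rw [intervalIntegral.integral_eq_sub_of_hasDerivAt (fun t _ => hv t)
      (hw.intervalIntegrable _ _)]
    ring
  · rw [intervalIntegral.integral_eq_sub_of_hasDerivAt (fun t _ => hu t)
      (hvc.intervalIntegrable _ _)]
    ring

lemma exists_isH2_cnoidal {L ω : ℝ} (hL : 0 < L) (hω : ω < 0) (n : ℕ+) (s : ℝ) :
    ∃ v w : ℝ → ℝ, IsH2 L (cnoidal L n ω s) v w ∧ cnoidal L n ω s 0 = cnoidal L n ω s L ∧
      v 0 = v L ∧ ∀ x, -w x - cnoidal L n ω s x ^ 3 = ω * cnoidal L n ω s x := by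
  obtain ⟨hk, -⟩ := modulus_spec hL hω n
  have hwave := wave_number_mul hL hω n
  have h2 := sq_lt_one_of_mem (Ioo_subset_Ico_self hk)
  have h1 := half_lt_sq_of_mem hk
  have hn : (0 : ℝ) < n := by exact_mod_cast n.pos
  have hcn : cnoidal L n ω s = fun x =>
    √(2 * |ω| * modulus L n ω ^ 2 / (2 * modulus L n ω ^ 2 - 1)) *
      jacobiCn (modulus L n ω) (√(|ω| / (2 * modulus L n ω ^ 2 - 1)) * (x - s)) := rfl
  rw [hcn]
  set k := modulus L n ω
  set A := √(2 * |ω| * k ^ 2 / (2 * k ^ 2 - 1)) with hA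
  set B := √(|ω| / (2 * k ^ 2 - 1)) with hB
  have hpos : 0 < 2 * k ^ 2 - 1 := by linarith
  have hA2 : A ^ 2 = 2 * k ^ 2 * B ^ 2 := by
    rw [hA, hB, Real.sq_sqrt (by positivity), Real.sq_sqrt (by positivity)]
    ring
  have hB2 : B ^ 2 * (2 * k ^ 2 - 1) = -ω := by
    rw [hB, Real.sq_sqrt (by positivity), div_mul_cancel₀ _ hpos.ne', abs_of_neg hω]
  have hlin : ∀ x, HasDerivAt (fun x => B * (x - s)) B x := fun x => by
    simpa using ((hasDerivAt_id x).sub_const s).const_mul B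
  have hcont : Continuous (jacobiCn k) :=
    continuous_iff_continuousAt.2 fun x => (hasDerivAt_jacobiCn h2 x).continuousAt
  have hBL : B * (L - s) = B * (0 - s) + (n : ℤ) * (4 * ellipticK k) := by
    rw [← hwave]
    push_cast
    field_simp
    ring
  refine ⟨fun x => A * (jacobiCnDeriv k (B * (x - s)) * B),
    fun x => A * (((2 * k ^ 2 - 1) * jacobiCn k (B * (x - s)) -
      2 * k ^ 2 * jacobiCn k (B * (x - s)) ^ 3) * B * B),
    isH2_of_hasDerivAt (fun x => ?_) (fun x => ?_) (by fun_prop), ?_, ?_, fun x => ?_⟩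
  · exact ((hasDerivAt_jacobiCn h2 _).comp x (hlin x)).const_mul A
  · exact (((hasDerivAt_jacobiCnDeriv h2 _).comp x (hlin x)).mul_const B).const_mul A
  · simp only
    rw [hBL, jacobiCn_add_int h2]
  · simp only
    rw [hBL, jacobiCnDeriv_add_int h2]
  · linear_combination (-A * jacobiCn k (B * (x - s)) ^ 3) * hA2 -
      A * jacobiCn k (B * (x - s)) * hB2

/-- The equation and periodicity hold for any shift, so once the symmetry is granted only the value
at 0 is a condition. -/
lemma solvesP_cnoidal_iff {σ L L₁ ω θ : ℝ} (hL : 0 < L) {n : ℕ+} {s : ℝ} (hω : ω < 0)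
    (hθ : θ ∈ Ioo (0 : ℝ) 1) (hsymm : cnoidal L n ω s 0 = σ * cnoidal L n ω s L₁)
    (hs : |√(|ω| / (2 * modulus L n ω ^ 2 - 1)) * (0 - s)| = θ * ellipticK (modulus L n ω)) :
    SolvesP σ L L₁ ω (cnoidal L n ω s) ↔ matchRatio (modulus L n ω) = θ := by
  obtain ⟨hk, -⟩ := modulus_spec hL hω n
  have hk0 := pos_of_mem (Ioo_subset_Ico_self hk)
  have hval : cnoidal L n ω s 0 = √(2 * |ω|) ↔ matchRatio (modulus L n ω) = θ := by
    have hpos : 0 < √(2 * modulus L n ω ^ 2 - 1) :=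
      Real.sqrt_pos.2 (by linarith [half_lt_sq_of_mem hk])
    have hω' : 0 < √(2 * |ω|) := Real.sqrt_pos.2 (by have := abs_pos.2 hω.ne; positivity)
    rw [← jacobiCn_eq_iff hk hθ, cnoidal,
      ← jacobiCn_abs (sq_lt_one_of_mem (Ioo_subset_Ico_self hk)), hs,
      Real.sqrt_div (by positivity), Real.sqrt_mul (by positivity), Real.sqrt_sq hk0.le,
      eq_div_iff hk0.ne', div_mul_eq_mul_div, div_eq_iff hpos.ne', mul_assoc,
      mul_right_inj' hω'.ne', mul_comm]
  rw [← hval]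
  constructor
  · rintro ⟨-, -, h1, h2⟩
    exact h1.trans h2
  · intro h
    obtain ⟨v, w, hH, h0, h1, hode⟩ := exists_isH2_cnoidal hL hω n s
    exact ⟨hω, ⟨v, w, hH, h0, h1, Eventually.of_forall hode⟩, hsymm, hsymm ▸ h⟩

/-- The frequency of the cnoidal wave of period `L / n` with matching ratio `θ`. -/
noncomputable def frequency (L : ℝ) (n : ℕ+) (θ : ℝ) : ℝ :=
  -(n * periodS (matchModulus θ) / L) ^ 2

lemma matchRatio_modulus_eq_iff {L ω θ : ℝ} (hL : 0 < L) (n : ℕ+) (hθ : θ ∈ Ioo (0 : ℝ) 1) :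
    (ω < 0 ∧ matchRatio (modulus L n ω) = θ) ↔ ω = frequency L n θ := by
  have hn : (0 : ℝ) < n := by exact_mod_cast n.pos
  have hmem := matchModulus_mem hθ
  have hS := periodS_pos hmem
  constructor
  · rintro ⟨hω, h⟩
    obtain ⟨hk, hper⟩ := modulus_spec hL hω n
    rw [matchRatio_eq_iff hk hθ] at h
    rw [frequency, ← h, hper, show (n : ℝ) * (L * √|ω| / n) / L = √|ω| by field_simp,
      Real.sq_sqrt (abs_nonneg _), abs_of_neg hω, neg_neg]
  · rintro rfl
    have hω : frequency L n θ < 0 := by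
      rw [frequency, neg_lt_zero]
      positivity
    refine ⟨hω, ?_⟩
    obtain ⟨hk, hper⟩ := modulus_spec hL hω n
    rw [matchRatio_eq_iff hk hθ]
    refine (strictMonoOn_periodS.mono Ioo_subset_Ico_self).injOn hk hmem ?_
    rw [hper, abs_of_neg hω, frequency, neg_neg, Real.sqrt_sq (by positivity)]
    field_simp

/-! ### The remainders `r_n` -/

lemma rSeq_eq (L L₁ : ℝ) (n : ℕ+) :
    rSeq L L₁ n = L₁ / L * n - round (L₁ / L * (n : ℝ)) := by
  rw [rSeq, round_eq]

lemma irrational_mul_pnat {ξ : ℝ} (hξ : Irrational ξ) (n : ℕ+) : Irrational (ξ * n) :=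
  hξ.mul_natCast n.ne_zero

lemma abs_rSeq_pos {L L₁ : ℝ} (hirr : Irrational (L₁ / L)) (n : ℕ+) : 0 < |rSeq L L₁ n| := by
  rw [rSeq_eq, abs_pos]
  exact ((irrational_mul_pnat hirr n).sub_intCast _).ne_zero

lemma abs_rSeq_lt {L L₁ : ℝ} (hirr : Irrational (L₁ / L)) (n : ℕ+) :
    |rSeq L L₁ n| < 1 / 2 := by
  rw [rSeq_eq]
  refine (abs_sub_round _).lt_of_ne fun h => ?_
  have hi := (irrational_mul_pnat hirr n).sub_intCast (round (L₁ / L * (n : ℝ)))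
  rcases abs_choice (L₁ / L * n - round (L₁ / L * (n : ℝ))) with h' | h' <;> rw [h'] at h
  · exact hi.ne_rat (1 / 2) (by push_cast; exact h)
  · exact hi.ne_rat (-1 / 2) (by push_cast; linarith)

lemma abs_rSeq_le (L L₁ : ℝ) (n : ℕ+) (p : ℤ) : |rSeq L L₁ n| ≤ |n * (L₁ / L) - p| := by
  rw [rSeq_eq, mul_comm (n : ℝ)]
  exact round_le _ p

/-- For odd `p` the integer `2j - p`, with `j` the nearest integer to `nξ`, is nonzero, hence at
least 1 in absolute value. -/
lemma one_sub_two_mul_abs_rSeq_le (L L₁ : ℝ) (n : ℕ+) {p : ℤ} (hp : Odd p) :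
    1 - 2 * |rSeq L L₁ n| ≤ |2 * n * (L₁ / L) - p| := by
  rw [rSeq_eq]
  generalize round (L₁ / L * (n : ℝ)) = j
  have hne : 2 * j - p ≠ 0 := by
    obtain ⟨i, rfl⟩ := hp
    omega
  have h1 : (1 : ℝ) ≤ |2 * (j : ℝ) - p| := by
    have := Int.one_le_abs hne
    rify at this
    exact this
  have h2 : (2 : ℝ) * j - p = (2 * n * (L₁ / L) - p) - 2 * (L₁ / L * n - j) := by ring
  rw [h2] at h1
  have h3 := abs_sub (2 * n * (L₁ / L) - p) (2 * (L₁ / L * n - j))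
  rw [abs_mul, abs_two] at h3
  linarith

lemma exists_shift_near_zero {L L₁ : ℝ} (hirr : Irrational (L₁ / L)) (N : ℕ) {ε : ℝ}
    (hε : 0 < ε) :
    ∃ n : ℕ+, N < (n : ℕ) ∧ 2 * |rSeq L L₁ n| < ε ∧ n * (2 * |rSeq L L₁ n|) ≤ 2 / √5 := by
  obtain ⟨δ, hδ, hN⟩ := exists_pos_le_abs_mul_sub hirr N
  obtain ⟨q, p, hq, hlt, hle⟩ :=
    exists_hurwitz_approximation hirr (ε := min (ε / 2) δ) (by positivity)
  have hNq := hN q p hq (hlt.trans_le (min_le_right _ _))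
  lift q to ℕ using hq.le
  have hr := abs_rSeq_le L L₁ ⟨q, by exact_mod_cast hq⟩ p
  rw [Int.cast_natCast] at hlt hle
  simp only [PNat.mk_coe] at hr
  refine ⟨⟨q, by exact_mod_cast hq⟩, by exact_mod_cast hNq, ?_, ?_⟩
  · linarith [hlt.trans_le (min_le_left _ _)]
  · have := (mul_le_mul_of_nonneg_left hr (Nat.cast_nonneg q)).trans hle
    simp only [PNat.mk_coe]
    rw [show 2 / √5 = 2 * (1 / √5) by ring]
    linarith

lemma exists_shift_near_half {L L₁ : ℝ} (hirr : Irrational (L₁ / L)) (N : ℕ) {ε : ℝ}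
    (hε : 0 < ε) :
    ∃ n : ℕ+, N < (n : ℕ) ∧ 1 - 2 * |rSeq L L₁ n| < ε ∧ n * (1 - 2 * |rSeq L L₁ n|) ≤ 1 / 2 := by
  -- The approximating denominator will be `2n`, so it has to exceed `2N`.
  obtain ⟨δ, hδ, hN⟩ := exists_pos_le_abs_mul_sub hirr (2 * N)
  obtain ⟨q, p, hq, heven, hodd, hlt, hle⟩ :=
    exists_odd_div_even_approximation hirr (ε := min ε δ) (by positivity)
  have hNq := hN q p hq (hlt.trans_le (min_le_right _ _))
  obtain ⟨m, rfl⟩ := heven.two_dvd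
  have hm : 0 < m := by omega
  lift m to ℕ using hm.le
  have hr := one_sub_two_mul_abs_rSeq_le L L₁ ⟨m, by exact_mod_cast hm⟩ hodd
  push_cast at hlt hle hNq
  simp only [PNat.mk_coe] at hr
  refine ⟨⟨m, by exact_mod_cast hm⟩, ?_, ?_, ?_⟩
  · simp only [PNat.mk_coe]
    omega
  · exact hr.trans_lt (hlt.trans_le (min_le_left _ _))
  · have := mul_le_mul_of_nonneg_left hr (Nat.cast_nonneg m)
    simp only [PNat.mk_coe]
    linarith

/-! ### Unboundedness and cluster points -/

lemma not_bddBelow_frequency {L : ℝ} (hL : 0 < L) {θ : ℕ+ → ℝ} (hθ : ∀ n, θ n ∈ Ioo (0 : ℝ) 1)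
    (h : ∀ N : ℕ, ∃ n : ℕ+, N < (n : ℕ) ∧ θ n < 1 / 2) :
    ¬ BddBelow (range fun n => frequency L n (θ n)) := by
  rintro ⟨B, hB⟩
  have hhalf : (1 / 2 : ℝ) ∈ Ioo (0 : ℝ) 1 := by norm_num
  have hmem := matchModulus_mem hhalf
  set c := periodS (matchModulus (1 / 2)) / L with hc
  have hc0 : 0 < c := div_pos (periodS_pos hmem) hL
  obtain ⟨N, hN⟩ := exists_nat_gt ((|B| + 1) / c)
  obtain ⟨n, hn, hn2⟩ := h N
  have hlt : matchModulus (1 / 2) < matchModulus (θ n) := strictAntiOn_matchModulus (hθ n) hhalf hn2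
  have hS := strictMonoOn_periodS (Ioo_subset_Ico_self hmem)
    (Ioo_subset_Ico_self (matchModulus_mem (hθ n))) hlt
  have hNn : (N : ℝ) < n := by exact_mod_cast hn
  have h1 : |B| + 1 < n * periodS (matchModulus (θ n)) / L := by
    rw [div_lt_iff₀ hc0] at hN
    calc |B| + 1 < N * c := hN
      _ ≤ n * c := by gcongr
      _ = n * periodS (matchModulus (1 / 2)) / L := by rw [hc]; ring
      _ ≤ _ := by gcongr
  have h2 : B ≤ frequency L n (θ n) := hB ⟨n, rfl⟩
  rw [frequency] at h2
  nlinarith [abs_nonneg B, neg_abs_le B]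

lemma neg_le_frequency {L : ℝ} (hL : 0 < L) {n : ℕ+} {θ C : ℝ} (hθ : θ ∈ Ioo (0 : ℝ) 1)
    (h : n * (1 - θ) ≤ C) :
    -(C * (4 * matchModulus θ ^ 2 * ellipticK (matchModulus θ) ^ 2) / L) ^ 2 ≤
      frequency L n θ := by
  have hS := periodS_le (matchModulus_mem hθ)
  have hS0 := periodS_pos (matchModulus_mem hθ)
  rw [matchRatio_matchModulus hθ] at hS
  rw [frequency, neg_le_neg_iff]
  refine pow_le_pow_left₀ (by positivity) (div_le_div_of_nonneg_right ?_ hL.le) 2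
  calc (n : ℝ) * periodS (matchModulus θ)
      ≤ n * (4 * matchModulus θ ^ 2 * ellipticK (matchModulus θ) ^ 2 * (1 - θ)) := by gcongr
    _ = n * (1 - θ) * (4 * matchModulus θ ^ 2 * ellipticK (matchModulus θ) ^ 2) := by ring
    _ ≤ _ := by gcongr

lemma exists_mapClusterPt_frequency {L C : ℝ} (hL : 0 < L) {θ : ℕ+ → ℝ}
    (hθ : ∀ n, θ n ∈ Ioo (0 : ℝ) 1)
    (h : ∀ (N : ℕ) (ε : ℝ), 0 < ε → ∃ n : ℕ+, N < (n : ℕ) ∧ 1 - θ n < ε ∧ n * (1 - θ n) ≤ C) :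
    ∃ x ∈ Icc (-(C * (2 * ellipticK (1 / √2) ^ 2) / L) ^ 2) 0,
      MapClusterPt x atTop fun n => frequency L n (θ n) := by
  choose f hf1 hf2 hf3 using fun j : ℕ => h j (1 / ((j : ℝ) + 1)) (by positivity)
  have hf : Tendsto f atTop atTop := tendsto_atTop_atTop.2 fun b => ⟨b, fun j hj => by
    have : (b : ℕ) ≤ f j := hj.trans (hf1 j).le
    exact_mod_cast this⟩
  have hθlim : Tendsto (fun j => θ (f j)) atTop (𝓝[<] 1) := by
    refine tendsto_nhdsWithin_iff.2 ⟨?_, Eventually.of_forall fun j => (hθ (f j)).2⟩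
    have h0 : Tendsto (fun j : ℕ => 1 - 1 / ((j : ℝ) + 1)) atTop (𝓝 1) := by
      simpa using tendsto_one_div_add_atTop_nhds_zero_nat.const_sub (1 : ℝ)
    exact tendsto_of_tendsto_of_tendsto_of_le_of_le h0 tendsto_const_nhds
      (fun j => by simp only; linarith [hf2 j]) fun j => (hθ (f j)).2.le
  have hk : Tendsto (fun j => matchModulus (θ (f j))) atTop (𝓝 (1 / √2)) :=
    (tendsto_matchModulus.comp hθlim).mono_right nhdsWithin_le_nhds
  have hK : Tendsto (fun j => ellipticK (matchModulus (θ (f j)))) atTop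
      (𝓝 (ellipticK (1 / √2))) := by
    have hmem : 1 / √2 ∈ Ioo (-1 : ℝ) 1 :=
      Ico_subset_Ioo_neg_one ⟨le_rfl, one_div_sqrt_two_lt_one⟩
    exact (continuousOn_ellipticK.continuousAt (isOpen_Ioo.mem_nhds hmem)).tendsto.comp hk
  set b : ℕ → ℝ := fun j => -(C * (4 * matchModulus (θ (f j)) ^ 2 *
    ellipticK (matchModulus (θ (f j))) ^ 2) / L) ^ 2
  have hb : Tendsto b atTop (𝓝 (-(C * (2 * ellipticK (1 / √2) ^ 2) / L) ^ 2)) := by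
    have := (((((hk.pow 2).const_mul 4).mul (hK.pow 2)).const_mul C).div_const L).pow 2 |>.neg
    rwa [one_div_sqrt_two_sq, show (4 : ℝ) * (1 / 2) = 2 by norm_num] at this
  have hbω : ∀ j, b j ≤ frequency L (f j) (θ (f j)) := fun j =>
    neg_le_frequency hL (hθ _) (hf3 j)
  have hω0 : ∀ j, frequency L (f j) (θ (f j)) ≤ 0 := fun j => neg_nonpos.2 (sq_nonneg _)
  obtain ⟨M, hM⟩ := hb.bddBelow_range
  -- The lower bounds `b j` converge, hence are bounded; compactness gives a limit point, and
  -- passing to the limit in `hbω` places it above `lim b`.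
  obtain ⟨x, hx, φ, hφ, hlim⟩ := (isCompact_Icc (a := M) (b := 0)).tendsto_subseq
    (x := fun j => frequency L (f j) (θ (f j)))
    fun j => ⟨(hM ⟨j, rfl⟩).trans (hbω j), hω0 j⟩
  refine ⟨x, ⟨le_of_tendsto_of_tendsto' (hb.comp hφ.tendsto_atTop) hlim fun j => hbω (φ j), hx.2⟩,
    ?_⟩
  exact MapClusterPt.of_comp (hf.comp hφ.tendsto_atTop) hlim.mapClusterPt

/-! ### The two shifts, and the conclusion -/

lemma isFrequencyPlus_iff {L L₁ : ℝ} (hL : 0 < L) (hirr : Irrational (L₁ / L)) (n : ℕ+) (ω : ℝ) :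
    IsFrequencyPlus L L₁ n ω ↔ ω = frequency L n (2 * |rSeq L L₁ n|) := by
  have hθ : 2 * |rSeq L L₁ n| ∈ Ioo (0 : ℝ) 1 :=
    ⟨by linarith [abs_rSeq_pos hirr n], by linarith [abs_rSeq_lt hirr n]⟩
  rw [← matchRatio_modulus_eq_iff hL n hθ]
  have hn : (0 : ℝ) < n := by exact_mod_cast n.pos
  have key : ω < 0 → (IsFrequencyPlus L L₁ n ω ↔
      matchRatio (modulus L n ω) = 2 * |rSeq L L₁ n|) := fun hω => by
    have hwave := wave_number_mul hL hω n
    have hk := sq_lt_one_of_mem (Ioo_subset_Ico_self (modulus_spec hL hω n).1)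
    have hK := ellipticK_pos hk
    set B := √(|ω| / (2 * modulus L n ω ^ 2 - 1))
    -- The phases at 0 and `L₁` are opposite modulo the period `4K`: the shift is the midpoint of 0
    -- and `L₁` modulo `L/n`.
    have hBs : B * (0 - shiftPlus L L₁ n) = -(2 * rSeq L L₁ n * ellipticK (modulus L n ω)) := by
      rw [shiftPlus]
      linear_combination (-rSeq L L₁ n / 2) * hwave
    have hBL : B * (L₁ - shiftPlus L L₁ n) = 2 * rSeq L L₁ n * ellipticK (modulus L n ω) +
        (round (L₁ / L * (n : ℝ)) : ℤ) * (4 * ellipticK (modulus L n ω)) := by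
      have hL₁ : L₁ = L / n * (rSeq L L₁ n + round (L₁ / L * (n : ℝ))) := by
        rw [rSeq_eq]
        field_simp
        ring
      have : B * (L₁ - shiftPlus L L₁ n) =
          B * (L / n) * (rSeq L L₁ n / 2 + round (L₁ / L * (n : ℝ))) := by
        rw [shiftPlus]
        linear_combination B * hL₁
      rw [this, hwave]
      ring
    refine solvesP_cnoidal_iff hL hω hθ ?_ ?_
    · rw [one_mul, cnoidal, cnoidal, hBs, hBL, jacobiCn_add_int hk, jacobiCn_neg hk]
    · rw [hBs, abs_neg, abs_mul, abs_mul, abs_two, abs_of_pos hK]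
  exact ⟨fun h => ⟨h.1, (key h.1).1 h⟩, fun h => (key h.1).2 h.2⟩

lemma isFrequencyMinus_iff {L L₁ : ℝ} (hL : 0 < L) (hirr : Irrational (L₁ / L)) (n : ℕ+)
    (ω : ℝ) : IsFrequencyMinus L L₁ n ω ↔ ω = frequency L n (1 - 2 * |rSeq L L₁ n|) := by
  have hr0 := abs_rSeq_pos hirr n
  have hr1 := abs_rSeq_lt hirr n
  have hθ : 1 - 2 * |rSeq L L₁ n| ∈ Ioo (0 : ℝ) 1 := ⟨by linarith, by linarith⟩
  rw [← matchRatio_modulus_eq_iff hL n hθ]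
  have hn : (0 : ℝ) < n := by exact_mod_cast n.pos
  have hsgn : |rSeq L L₁ n| * Real.sign (rSeq L L₁ n) = rSeq L L₁ n := by
    rcases (abs_pos.1 hr0).lt_or_gt with h | h
    · rw [abs_of_neg h, Real.sign_of_neg h]; ring
    · rw [abs_of_pos h, Real.sign_of_pos h]; ring
  have hsgn1 : Real.sign (rSeq L L₁ n) = -1 ∨ Real.sign (rSeq L L₁ n) = 1 :=
    Real.sign_apply_eq_of_ne_zero _ (abs_pos.1 hr0)
  have key : ω < 0 → (IsFrequencyMinus L L₁ n ω ↔
      matchRatio (modulus L n ω) = 1 - 2 * |rSeq L L₁ n|) := fun hω => by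
    have hwave := wave_number_mul hL hω n
    have hk := sq_lt_one_of_mem (Ioo_subset_Ico_self (modulus_spec hL hω n).1)
    have hK := ellipticK_pos hk
    have hshift : shiftMinus L L₁ n = L / n *
        ((|rSeq L L₁ n| - 1 / 2) * Real.sign (rSeq L L₁ n) / 2) := by
      rw [shiftMinus]
      field_simp
    set r := rSeq L L₁ n
    set e := Real.sign r
    set B := √(|ω| / (2 * modulus L n ω ^ 2 - 1))
    have hBs : B * (0 - shiftMinus L L₁ n) =
        e * ((1 - 2 * |r|) * ellipticK (modulus L n ω)) := by
      rw [hshift]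
      linear_combination (-(|r| - 1 / 2) * e / 2) * hwave
    have hBL : B * (L₁ - shiftMinus L L₁ n) = (2 * r + e) * ellipticK (modulus L n ω) +
        (round (L₁ / L * (n : ℝ)) : ℤ) * (4 * ellipticK (modulus L n ω)) := by
      have hL₁ : L₁ = L / n * (r + round (L₁ / L * (n : ℝ))) := by
        rw [show r = _ from rSeq_eq L L₁ n]
        field_simp
        ring
      have : B * (L₁ - shiftMinus L L₁ n) =
          B * (L / n) * (r / 2 + e / 4 + round (L₁ / L * (n : ℝ))) := by
        rw [hshift]
        linear_combination B * hL₁ - B * L / n / 2 * hsgn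
      rw [this, hwave]
      ring
    -- After a reflection the two phases differ by the half period `2K`, which changes the sign of
    -- `cn`.
    have hneg : jacobiCn (modulus L n ω) ((2 * r + e) * ellipticK (modulus L n ω)) =
        -jacobiCn (modulus L n ω) (e * ((1 - 2 * |r|) * ellipticK (modulus L n ω))) := by
      rcases hsgn1 with he | he
      · have habs : |r| = -r := by rw [he] at hsgn; linarith
        rw [he, habs, ← jacobiCn_neg hk (-1 * _), eq_neg_iff_add_eq_zero, add_comm,
          ← eq_neg_iff_add_eq_zero, ← jacobiCn_add_half hk]
        congr 1
        ring
      · have habs : |r| = r := by rw [he] at hsgn; linarith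
        rw [he, habs, ← jacobiCn_neg hk (1 * _), ← jacobiCn_add_half hk]
        congr 1
        ring
    refine solvesP_cnoidal_iff hL hω hθ ?_ ?_
    · rw [cnoidal, cnoidal, hBs, hBL, jacobiCn_add_int hk, hneg]
      ring
    · have he1 : |e| = 1 := by rcases hsgn1 with he | he <;> rw [he] <;> norm_num
      rw [hBs, abs_mul, he1, one_mul, abs_of_nonneg (mul_nonneg hθ.1.le hK.le)]
  exact ⟨fun h => ⟨h.1, (key h.1).1 h⟩, fun h => (key h.1).2 h.2⟩

theorem theorem3 (L₁ L₂ L : ℝ) (hL₁ : 0 < L₁) (hL₂ : L₁ ≤ L₂) (hL : L = L₁ + L₂)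
    (hirr : Irrational (L₁ / L)) :
    ∃ ωp ωm : ℕ+ → ℝ,
      (∀ (n : ℕ+) (ω : ℝ), IsFrequencyPlus L L₁ n ω ↔ ω = ωp n) ∧
      (∀ (n : ℕ+) (ω : ℝ), IsFrequencyMinus L L₁ n ω ↔ ω = ωm n) ∧
      ¬ BddBelow (range ωp) ∧
      ¬ BddBelow (range ωm) ∧
      (∃ x ∈ Icc (-(1 / L ^ 2 * ellipticK (1 / √2) ^ 4)) 0, MapClusterPt x atTop ωp) ∧
      (∃ x ∈ Icc (-(16 / (5 * L ^ 2) * ellipticK (1 / √2) ^ 4)) 0, MapClusterPt x atTop ωm) := by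
  have hLpos : 0 < L := by linarith
  have hr0 := abs_rSeq_pos hirr
  have hr1 := abs_rSeq_lt hirr
  have hθp : ∀ n, 2 * |rSeq L L₁ n| ∈ Ioo (0 : ℝ) 1 :=
    fun n => ⟨by linarith [hr0 n], by linarith [hr1 n]⟩
  have hθm : ∀ n, 1 - 2 * |rSeq L L₁ n| ∈ Ioo (0 : ℝ) 1 :=
    fun n => ⟨by linarith [hr1 n], by linarith [hr0 n]⟩
  refine ⟨fun n => frequency L n (2 * |rSeq L L₁ n|),
    fun n => frequency L n (1 - 2 * |rSeq L L₁ n|),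
    isFrequencyPlus_iff hLpos hirr, isFrequencyMinus_iff hLpos hirr,
    not_bddBelow_frequency hLpos hθp fun N => ?_, not_bddBelow_frequency hLpos hθm fun N => ?_,
    ?_, ?_⟩
  · obtain ⟨n, h1, h2, -⟩ := exists_shift_near_zero hirr N (ε := 1 / 2) (by norm_num)
    exact ⟨n, h1, h2⟩
  · obtain ⟨n, h1, h2, -⟩ := exists_shift_near_half hirr N (ε := 1 / 2) (by norm_num)
    exact ⟨n, h1, h2⟩
  -- Here `C = 1/2`, so `(2C)² = 1`.
  · have := exists_mapClusterPt_frequency hLpos hθp fun N ε hε => exists_shift_near_half hirr N hε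
    convert this using 5
    field_simp
  -- Here `(2C)² = 16/5`.
  · have := exists_mapClusterPt_frequency (C := 2 / √5) hLpos hθm fun N ε hε => by
      simpa only [sub_sub_cancel] using exists_shift_near_zero hirr N hε
    have h5 : √5 ^ 2 = (5 : ℝ) := Real.sq_sqrt (by norm_num)
    convert this using 5
    rw [div_pow, mul_pow, div_pow, h5]
    field_simp
    ring
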